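/- For lists of complex numbers, ${}_pF_q\left(\begin{smallmatrix}a_1,\dots,a_p\\ b_1,\dots,b_q\end{smallmatrix}\middle|z\right)=\sum_{k\ge0}\frac{(a_1)_k\cdots(a_p)_k}{(b_1)_k\cdots(b_q)_k}\frac{z^k}{k!}$ with $(x)_k=x(x+1)\cdots(x+k-1)$; the series is summed as the limit of its partial sums, and $z=1$ if the argument is omitted. Let $A,B,C,D,E,G,\omega\in\mathbb C$ satisfy $A-B-C-G\neq0$ and $$\omega^2=\frac{GBC}{A-B-C-G}+\frac{A^2}{4}.$$ (1) Let $F=-n$ with $n\in\{0,1,2,\dots\}$. Suppose that $(b)_k\ne0$ for every $0\le k\le n$ and every lower parameter $b$ of the two series below, and that none of $A+1$, $1+A-D-F$, $1+A-E-F$, $1+A-D-E$ is a non-positive integer. Then $$ {}_{5}F_{4}\left(\begin{matrix}A-B-C,D,E,F,G+1\\ 1+A-B,1+A-C,D+E+F-A,G\end{matrix}\right) =\frac{\Gamma(A+1)\Gamma(1+A-D-F)\Gamma(1+A-E-F)\Gamma(1+A-D-E)}{\Gamma(1+A-F)\Gamma(1+A-D)\Gamma(1+A-E)\Gamma(1+A-D-E-F)}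 $$ $$ \times{}_{9}F_{8}\left(\begin{matrix}A,1+\frac A2,B,C,D,E,F,\frac A2-\omega+1,\frac A2+\omega+1\\ \frac A2,1+A-B,1+A-C,1+A-D,1+A-E,1+A-F,\frac A2-\omega,\frac A2+\omega\end{matrix}\right), $$ where both series terminate (all terms with $k>n$ are zero). (2) Suppose that no lower parameter of the two series below is a non-positive integer, that neither $A+1$ nor $1+A-D-E$ is a non-positive integer, that $\operatorname{Re}(1+A-D-E)>0$ or the series ${}_4F_3$ terminates (one of $A-B-C,D,E$ is a non-positive integer), and that $\operatorname{Re}(3A+2-2(B+C+D+E))>0$ or the series ${}_8F_7$ terminates (one of $B,C,D,E$ is a non-positive integer). Then both series converge (possibly conditionally) and $$ {}_{4}F_{3}\left(\begin{matrix}A-B-C,D,E,G+1\\ 1+A-B,1+A-C,G\end{matrix}\right) =\frac{\Gamma(A+1)\Gamma(1+A-D-E)}{\Gamma(1+A-D)\Gamma(1+A-E)} $$ $$ \times{}_{8}F_{7}\left(\begin{matrix}A,1+\frac A2,B,C,D,E,\frac A2-\omega+1,\frac A2+\omega+1\\ \frac A2,1+A-B,1+A-C,1+A-D,1+A-E,\frac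 A2-\omega,\frac A2+\omega\end{matrix}\middle|-1\right). $$ -/

import Mathlib

open Filter Topology

/-- The `k`-th term of the generalized hypergeometric series with upper parameters `a`,
lower parameters `b` and argument `z`:
`((a₁)_k ⋯ (a_p)_k) / ((b₁)_k ⋯ (b_q)_k) * z ^ k / k!`, where `(x)_k = x (x+1) ⋯ (x+k-1)`. -/
noncomputable def hypTerm (a b : List ℂ) (z : ℂ) (k : ℕ) : ℂ :=
  (a.map fun x => (ascPochhammer ℂ k).eval x).prod /
    (b.map fun x => (ascPochhammer ℂ k).eval x).prod * z ^ k / (k.factorial : ℂ)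

/-- The generalized hypergeometric series converges, possibly conditionally (as the limit of its
partial sums in the natural order), and its sum is `S`. -/
def HasHypSum (a b : List ℂ) (z S : ℂ) : Prop :=
  Tendsto (fun N : ℕ => ∑ k ∈ Finset.range N, hypTerm a b z k) atTop (𝓝 S)

/-- `x` is a non-positive integer (a pole of the Gamma function). -/
def IsNonposInt (x : ℂ) : Prop := ∃ m : ℕ, x = -(m : ℂ)

/-- None of the denominators `(x)_k`, `x ∈ b`, `k ≤ n`, vanishes: the terms of index at most `n`
of a hypergeometric series with lower parameters `b` are defined. -/
def LowerNonzero (b : List ℂ) (n : ℕ) : Prop :=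
  ∀ x ∈ b, ∀ k : ℕ, k < n → x + (k : ℂ) ≠ 0

/-! The terminating identity is an instance of Bailey's transform. For a sequence `α` put `β m =
∑_{k ≤ m} α k / ((m-k)! (1+A)_{m+k})`. Weight `β m` by `(D)_m (E)_m (-n)_m / (D+E-n-A)_m`, sum over
`m` and interchange the sums: the inner sum is Saalschützian, hence a product (`bailey_transform`).
It remains to find `α` whose `β` gives the coefficients on the left.

The choice is `quadPoised`: very-well-poised coefficients in `B`, `C` times `(k^2 + A k + P) / P`
with `P = (A/2-ω)(A/2+ω)`. The quadratic is `(k + A/2 - ω)(k + A/2 + ω)`, which produces the two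
parameter pairs containing `ω`. Its `β` follows from the very-well-poised `₅F₄` sum, plain and
weighted by `k(k+A)`. For `m ≥ 1` the result is a multiple of `(1+A-B-C)_{m-1}` by a polynomial
linear in `m`, and the equation for `ω` says exactly that its root is `m = -G`; this is the pair
`G+1`, `G` (`sum_quadPoised`).

The non-terminating identity is the limit `n → ∞`. On the left `(-n)_k / (D+E-n-A)_k → 1`; on the
right `(-n)_k / (1+A+n)_k → (-1)^k`, hence the argument `-1`. If neither series terminates, the
limits need two different arguments. On the left the series converges absolutely, but the extra
factors may blow up for `k` near `n`, so the tails are compared with a majorant that telescopes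
exactly. On the right convergence may be conditional: consecutive terms are paired, and dominated
convergence applies to the pairs. -/

open Asymptotics

/-! ### Rising factorials -/

/-- The rising factorial `(x)_k = x (x+1) ⋯ (x+k-1)`. -/
noncomputable def poch (x : ℂ) (k : ℕ) : ℂ := (ascPochhammer ℂ k).eval x

@[simp] lemma poch_zero (x : ℂ) : poch x 0 = 1 := by simp [poch]

lemma poch_succ (x : ℂ) (k : ℕ) : poch x (k + 1) = poch x k * (x + k) :=
  ascPochhammer_succ_eval k x

lemma poch_succ_left (x : ℂ) (k : ℕ) : poch x (k + 1) = x * poch (x + 1) k := by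
  simp [poch, ascPochhammer_succ_left, Polynomial.eval_comp]

lemma poch_add (x : ℂ) (m k : ℕ) : poch x (m + k) = poch x m * poch (x + m) k := by
  simp [poch, ← ascPochhammer_mul, Polynomial.eval_comp]

lemma poch_eq_prod (x : ℂ) (k : ℕ) : poch x k = ∏ j ∈ Finset.range k, (x + j) := by
  induction k with
  | zero => simp
  | succ k ih => rw [poch_succ, ih, Finset.prod_range_succ]

lemma poch_ne_zero {x : ℂ} {k : ℕ} (h : ∀ j < k, x + (j : ℂ) ≠ 0) : poch x k ≠ 0 := by
  rw [poch_eq_prod]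
  exact Finset.prod_ne_zero_iff.2 fun j hj => h j (Finset.mem_range.1 hj)

lemma poch_neg_nat_eq_zero {n k : ℕ} (h : n < k) : poch (-(n : ℂ)) k = 0 := by
  rw [poch_eq_prod]
  exact Finset.prod_eq_zero (Finset.mem_range.2 h) (by simp)

lemma poch_one (k : ℕ) : poch 1 k = (k.factorial : ℂ) := by
  simp [poch]

/-- Reversal of the order of the factors of a rising factorial. -/
lemma poch_reverse (s : ℂ) {n m : ℕ} (h : m ≤ n) :
    poch (1 - s - n) m * poch s (n - m) = (-1) ^ m * poch s n := by
  induction m with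
  | zero => simp
  | succ m ih =>
    have h1 : n - m = n - (m + 1) + 1 := by omega
    have ih := ih (by omega)
    rw [h1, poch_succ, Nat.cast_sub h] at ih
    rw [poch_succ, pow_succ]
    push_cast at ih ⊢
    linear_combination -ih

lemma poch_neg_nat {n m : ℕ} (h : m ≤ n) :
    poch (-(n : ℂ)) m * (n - m).factorial = (-1) ^ m * n.factorial := by
  have := poch_reverse 1 h
  rwa [poch_one, poch_one, show (1 : ℂ) - 1 - n = -n by ring] at this

/-! ### Finite summation formulas -/

/-- The Pfaff–Saalschütz summation in polynomial form. -/
theorem pfaff_saalschutz (a b c d : ℂ) (h : d = c - a - b) (N : ℕ) :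
    ∑ j ∈ Finset.range (N + 1), (N.choose j : ℂ) *
      (poch a j * poch b j * (poch (c + j) (N - j) * poch d (N - j))) =
      poch (c - a) N * poch (c - b) N := by
  induction N with
  | zero => simp
  | succ N ih =>
    rw [Finset.sum_choose_succ_mul (fun j l => poch a j * poch b j * (poch (c + j) l * poch d l)),
      poch_succ, poch_succ]
    -- `H` is a telescoping certificate: Pascal's rule splits the sum for `N + 1`, and its defect
    -- from `(c-a+N)(c-b+N)` times the sum for `N` is `H (j+1) - H j`. Both `H 0` and `H (N+1)`
    -- vanish.
    obtain ⟨H, hH⟩ : ∃ H : ℕ → ℂ, ∀ j, H j = (j : ℂ) * N.choose j * (poch a j * poch b j *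
        (poch (c + j) (N - j) * poch d (N + 1 - j))) := ⟨_, fun _ => rfl⟩
    have key : ∀ j ∈ Finset.range (N + 1),
        (N.choose j : ℂ) * (poch a j * poch b j * (poch (c + j) (N + 1 - j) * poch d (N + 1 - j)))
        + (N.choose j : ℂ) * (poch a (j + 1) * poch b (j + 1) *
          (poch (c + (j + 1 : ℕ)) (N - j) * poch d (N - j)))
        - (c - a + N) * (c - b + N) * ((N.choose j : ℂ) *
          (poch a j * poch b j * (poch (c + j) (N - j) * poch d (N - j)))) = H (j + 1) - H j := by
      intro j hj
      obtain ⟨l, rfl⟩ := Nat.exists_eq_add_of_le (Nat.lt_succ_iff.1 (Finset.mem_range.1 hj))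
      rw [hH, hH]
      rcases l with _ | l
      · simp only [add_zero, Nat.choose_self, Nat.choose_succ_self, Nat.sub_self,
          Nat.add_sub_cancel_left, poch_zero, poch_succ]
        simp only [Nat.cast_one, Nat.cast_zero, h]
        ring
      · have e1 : j + (l + 1) + 1 - j = l + 2 := by omega
        have e2 : j + (l + 1) - j = l + 1 := by omega
        have e3 : j + (l + 1) - (j + 1) = l := by omega
        have e4 : j + (l + 1) + 1 - (j + 1) = l + 1 := by omega
        have hc := congrArg (Nat.cast : ℕ → ℂ) (Nat.choose_succ_right_eq (j + (l + 1)) j)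
        rw [e2] at hc
        push_cast at hc
        simp only [e1, e2, e3, e4]
        rw [poch_succ_left (c + j) (l + 1), poch_succ_left (c + j) l]
        simp only [poch_succ]
        push_cast
        rw [add_assoc c (j : ℂ) 1]
        subst h
        linear_combination (-(poch a j * (a + j) * poch b j * (b + j) * poch (c + (j + 1)) l *
          poch (c - a - b) l * (c - a - b + l))) * hc
    have tele := Finset.sum_congr rfl key
    rw [Finset.sum_range_sub, Finset.sum_sub_distrib, Finset.sum_add_distrib, ← Finset.mul_sum, ih]
      at tele
    simp only [hH, Nat.choose_succ_self, Nat.cast_zero, mul_zero, zero_mul, sub_zero] at tele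
    linear_combination tele

/-- The term of the terminating very-well-poised `₅F₄`, with denominators cleared except for
those coming from `(1 + A + m)_k`. -/
noncomputable def wellPoisedTerm (A B C : ℂ) (k l : ℕ) : ℂ :=
  (-1) ^ k * (poch B k * poch C k * (poch (1 + A - B + k) l * poch (1 + A - C + k) l))

/-- The terminating very-well-poised `₅F₄` summation. -/
theorem sum_wellPoised (m : ℕ) : ∀ (A B C : ℂ), (∀ k : ℕ, A + k ≠ 0) →
    ∑ k ∈ Finset.range (m + 1), (m.choose k : ℂ) * ((A + 2 * k) / poch (A + k) (m + 1) *
      wellPoisedTerm A B C k (m - k)) = poch (1 + A - B - C) m := by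
  induction m with
  | zero =>
    intro A B C hA
    have := hA 0
    simp only [Nat.cast_zero, add_zero] at this
    simp [wellPoisedTerm, poch_succ, this]
  | succ m ih =>
    intro A B C hA
    have hp : ∀ k l : ℕ, poch (A + k) l ≠ 0 := fun k l => poch_ne_zero fun j _ => by
      simpa [add_assoc] using hA (k + j)
    have hp1 : ∀ k l : ℕ, poch (A + k + 1) l ≠ 0 := fun k l => by
      simpa [add_assoc] using hp (k + 1) l
    have hm : (m : ℂ) + 1 ≠ 0 := by exact_mod_cast Nat.succ_ne_zero m
    -- This is the partial fraction `(m+1)(A+2k) = (m+1-k)(A+k) + k(A+k+m+1)`. With the second sum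
    -- shifted by one, both parts carry `C(m,k) / (A+k+1)_{m+1}`, and they combine through
    -- `(1+A-B+k)(1+A-C+k) - (B+k)(C+k) = (1+A-B-C)(1+A+2k)` into the summand for `A + 1`.
    have split : ∀ k ∈ Finset.range (m + 1 + 1),
        ((m + 1).choose k : ℂ) * ((A + 2 * k) / poch (A + k) (m + 1 + 1) *
          wellPoisedTerm A B C k (m + 1 - k)) =
        (m.choose k : ℂ) / poch (A + k + 1) (m + 1) * wellPoisedTerm A B C k (m + 1 - k) +
        (k * (m + 1).choose k : ℂ) / ((m + 1) * poch (A + k) (m + 1)) *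
          wellPoisedTerm A B C k (m + 1 - k) := by
      intro k hk
      have hk : k ≤ m + 1 := Nat.lt_succ_iff.1 (Finset.mem_range.1 hk)
      have hc := congrArg (Nat.cast : ℕ → ℂ) (Nat.choose_mul_succ_eq m k)
      rw [Nat.cast_mul, Nat.cast_mul, Nat.cast_sub hk] at hc
      push_cast at hc
      have h1 := poch_succ (A + k) (m + 1)
      have h2 := poch_succ_left (A + k) (m + 1)
      have h3 : A + k + ((m : ℂ) + 1) ≠ 0 := by simpa [add_assoc] using hA (k + (m + 1))
      have hc' : (m.choose k : ℂ) = (m + 1).choose k * (m + 1 - k) / (m + 1) := by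
        rw [eq_div_iff hm, hc]
      have e1 : (A + 2 * k) / poch (A + k) (m + 1 + 1) =
          (m + 1 - k) / ((m + 1) * poch (A + k + 1) (m + 1)) +
            k / ((m + 1) * poch (A + k) (m + 1)) := by
        have e2 : poch (A + k + 1) (m + 1) = poch (A + k) (m + 1) * (A + k + (m + 1)) / (A + k) := by
          rw [eq_div_iff (hA k), mul_comm, ← h2, h1]
          push_cast
          ring
        rw [e2, h1]
        have := hp k (m + 1)
        have := hA k
        push_cast
        field_simp
        ring
      rw [e1, hc']
      field_simp
    rw [Finset.sum_congr rfl split, Finset.sum_add_distrib, Finset.sum_range_succ,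
      Finset.sum_range_succ' (fun k : ℕ => (k * (m + 1).choose k : ℂ) / _ * _)]
    simp only [Nat.choose_succ_self, Nat.cast_zero, zero_div, zero_mul, add_zero]
    rw [← Finset.sum_add_distrib, poch_succ_left, show 1 + A - B - C + 1 = 1 + (A + 1) - B - C by ring,
      ← ih (A + 1) B C (fun k => by simpa [add_assoc, add_comm, add_left_comm] using hA (k + 1)), Finset.mul_sum]
    refine Finset.sum_congr rfl fun k hk => ?_
    obtain ⟨l, rfl⟩ := Nat.exists_eq_add_of_le (Nat.lt_succ_iff.1 (Finset.mem_range.1 hk))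
    have hc := congrArg (Nat.cast : ℕ → ℂ) (Nat.add_one_mul_choose_eq (k + l) k)
    push_cast at hc hm
    have e1 : k + l + 1 - k = l + 1 := by omega
    have e2 : k + l + 1 - (k + 1) = l := by omega
    have e3 : k + l - k = l := by omega
    rw [e1, e2, e3]
    have hh : ((k : ℂ) + 1) * (k + l + 1).choose (k + 1) / ((k + l + 1)) = (k + l).choose k := by
      rw [div_eq_iff hm]
      linear_combination -hc
    have hq := hp1 k (k + l + 1)
    have e4 : A + (k + 1 : ℕ) = A + k + 1 := by push_cast; ring
    have e5 : A + 1 + (k : ℂ) = A + k + 1 := by ring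
    push_cast
    rw [← add_assoc A (k : ℂ) 1, ← div_div, hh, e5]
    simp only [wellPoisedTerm, poch_succ_left _ l, poch_succ _ k, pow_succ]
    push_cast
    rw [show 1 + A - B + (k : ℂ) + 1 = 1 + (A + 1) - B + k by ring,
      show 1 + A - C + (k : ℂ) + 1 = 1 + (A + 1) - C + k by ring,
      show 1 + A - B + ((k : ℂ) + 1) = 1 + (A + 1) - B + k by ring,
      show 1 + A - C + ((k : ℂ) + 1) = 1 + (A + 1) - C + k by ring]
    field_simp
    ring

/-- The very-well-poised sum weighted with `k (k + A)`. -/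
theorem sum_wellPoised_weighted (m : ℕ) (A B C : ℂ) (hA : ∀ k : ℕ, A + k ≠ 0) :
    ∑ k ∈ Finset.range (m + 1 + 1), ((m + 1).choose k : ℂ) * ((A + 2 * k) /
      poch (A + k) (m + 1 + 1) * wellPoisedTerm A B C k (m + 1 - k)) * (k * (k + A)) =
      -((m + 1) * B * C * poch (1 + A - B - C) m) := by
  -- The weight kills `k = 0`. After `k → k + 1`, `k` is absorbed by the binomial coefficient and `k
  -- + A` by the first factor of the denominator, leaving the unweighted sum with shifted
  -- parameters.
  have h := sum_wellPoised m (A + 2) (B + 1) (C + 1)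
    (fun k => by simpa [add_assoc, add_comm, add_left_comm] using hA (k + 2))
  rw [show 1 + (A + 2) - (B + 1) - (C + 1) = 1 + A - B - C by ring] at h
  rw [Finset.sum_range_succ', ← h, Finset.mul_sum, ← Finset.sum_neg_distrib]
  simp only [Nat.cast_zero, zero_mul, mul_zero, add_zero]
  refine Finset.sum_congr rfl fun k hk => ?_
  have hc := congrArg (Nat.cast : ℕ → ℂ) (Nat.add_one_mul_choose_eq m k)
  have hp : poch (A + k + 2) (m + 1) ≠ 0 := poch_ne_zero fun j _ => by
    have := hA (k + 2 + j)
    push_cast at this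
    convert this using 1
    ring
  have hk1 := hA (k + 1)
  push_cast at hc hk1
  rw [Nat.add_sub_add_right, poch_succ_left]
  simp only [wellPoisedTerm, poch_succ_left _ k, pow_succ]
  push_cast
  rw [show A + ((k : ℂ) + 1) + 1 = A + k + 2 by ring, show A + 2 + (k : ℂ) = A + k + 2 by ring,
    show 1 + (A + 2) - (B + 1) + (k : ℂ) = 1 + A - B + (k + 1) by ring,
    show 1 + (A + 2) - (C + 1) + (k : ℂ) = 1 + A - C + (k + 1) by ring]
  field_simp
  linear_combination ((A + k + 1) * (A + 2 * k + 2) * B * poch (B + 1) k * C * poch (C + 1) k *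
    poch (1 + A - B + (k + 1)) (m - k) * poch (1 + A - C + (k + 1)) (m - k)) * hc

/-! ### Bailey's transform and the terminating identity -/

/-- Both symbols are reversed and the signs cancel. Applied with `s = 1 + A - D - E`, this turns the
balanced quotient into the `(d)_{N-j}` and binomial coefficient of `pfaff_saalschutz`. -/
lemma poch_neg_nat_div {s : ℂ} (hs : ∀ k : ℕ, s + k ≠ 0) {n m : ℕ} (h : m ≤ n) :
    poch (-(n : ℂ)) m / poch (1 - s - n) m =
      n.factorial / (n - m).factorial * (poch s (n - m) / poch s n) := by
  have h1 := poch_reverse s h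
  have h2 := poch_neg_nat h
  have hs' : ∀ k, poch s k ≠ 0 := fun k => poch_ne_zero fun j _ => hs j
  have h3 : ((n - m).factorial : ℂ) ≠ 0 := by exact_mod_cast Nat.factorial_ne_zero _
  have h4 : ((-1 : ℂ)) ^ m ≠ 0 := by simp
  have h5 : poch (1 - s - n) m ≠ 0 := left_ne_zero_of_mul (h1 ▸ mul_ne_zero h4 (hs' n))
  have := hs' n
  field_simp
  apply mul_left_cancel₀ h4
  linear_combination (-poch (-(n : ℂ)) m * (n - m).factorial) * h1 +
    (poch (1 - s - n) m * poch s (n - m)) * h2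

/-- Bailey's transform for the conjugate pair given by the Pfaff–Saalschütz summation. -/
theorem bailey_transform (A D E : ℂ) (n : ℕ) (α : ℕ → ℂ) (hA : ∀ k : ℕ, 1 + A + k ≠ 0)
    (hs : ∀ k : ℕ, 1 + A - D - E + k ≠ 0) (hD : ∀ k < n, 1 + A - D + (k : ℂ) ≠ 0)
    (hE : ∀ k < n, 1 + A - E + (k : ℂ) ≠ 0) :
    ∑ m ∈ Finset.range (n + 1), poch D m * poch E m *
      (poch (-(n : ℂ)) m / poch (D + E + -(n : ℂ) - A) m) *
        ∑ k ∈ Finset.range (m + 1), α k / ((m - k).factorial * poch (1 + A) (m + k)) =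
    poch (1 + A - D) n * poch (1 + A - E) n / (poch (1 + A) n * poch (1 + A - D - E) n) *
      ∑ k ∈ Finset.range (n + 1), poch D k * poch E k * poch (-(n : ℂ)) k * (-1) ^ k /
        (poch (1 + A - D) k * poch (1 + A - E) k * poch (1 + A - -(n : ℂ)) k) * α k := by
  simp_rw [Finset.mul_sum]
  rw [Finset.sum_comm' (t' := Finset.range (n + 1)) (s' := fun k => Finset.Ico k (n + 1))
    (by intro x y; simp only [Finset.mem_range, Finset.mem_Ico]; omega)]
  refine Finset.sum_congr rfl fun k hk => ?_
  obtain ⟨N, rfl⟩ := Nat.exists_eq_add_of_le (Nat.lt_succ_iff.1 (Finset.mem_range.1 hk))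
  have hpA : ∀ m, poch (1 + A) m ≠ 0 := fun m => poch_ne_zero fun j _ => hA j
  have hps : ∀ m, poch (1 + A - D - E) m ≠ 0 := fun m => poch_ne_zero fun j _ => hs j
  have hf : ∀ m : ℕ, (m.factorial : ℂ) ≠ 0 := fun m => by exact_mod_cast Nat.factorial_ne_zero _
  have hDk : poch (1 + A - D) k ≠ 0 := poch_ne_zero fun j hj => hD j (by omega)
  have hEk : poch (1 + A - E) k ≠ 0 := poch_ne_zero fun j hj => hE j (by omega)
  -- With `n = k + N` and `m = k + j`, the inner sum is Saalschützian with all parameters shifted by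
  -- `k`; the shifts cancel in `c - a - b`.
  have sa := pfaff_saalschutz (D + k) (E + k) (1 + A + 2 * k) (1 + A - D - E) (by ring) N
  rw [Finset.sum_Ico_eq_sum_range, show k + N + 1 - k = N + 1 by omega]
  have step : ∀ j ∈ Finset.range (N + 1),
      poch D (k + j) * poch E (k + j) * (poch (-((k + N : ℕ) : ℂ)) (k + j) /
        poch (D + E + -((k + N : ℕ) : ℂ) - A) (k + j)) *
          (α k / ((k + j - k).factorial * poch (1 + A) (k + j + k))) =
      (poch D k * poch E k * α k * (k + N).factorial / (N.factorial * poch (1 + A) (2 * k + N) *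
        poch (1 + A - D - E) (k + N))) * ((N.choose j : ℂ) * (poch (D + k) j * poch (E + k) j *
      (poch (1 + A + 2 * k + j) (N - j) * poch (1 + A - D - E) (N - j)))) := by
    intro j hj
    obtain ⟨l, rfl⟩ := Nat.exists_eq_add_of_le (Nat.lt_succ_iff.1 (Finset.mem_range.1 hj))
    have h1 : D + E + -((k + (j + l) : ℕ) : ℂ) - A =
      1 - (1 + A - D - E) - ((k + (j + l) : ℕ) : ℂ) := by ring
    rw [h1, poch_neg_nat_div hs (by omega), show k + (j + l) - (k + j) = l by omega,
      show j + l - j = l by omega, show k + j - k = j by omega,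
      show 2 * k + (j + l) = (k + j + k) + l by omega, poch_add (1 + A) (k + j + k), poch_add D, poch_add E]
    have h2 : ((j + l).choose j : ℂ) = (j + l).factorial / (j.factorial * l.factorial) := Nat.cast_add_choose ℂ
    have h3 : 1 + A + ((k + j + k : ℕ) : ℂ) = 1 + A + 2 * k + j := by push_cast; ring
    have h4 : poch (1 + A + ((k + j + k : ℕ) : ℂ)) l ≠ 0 := poch_ne_zero fun i _ => by
      simpa [add_assoc] using hA (k + j + k + i)
    rw [h3] at h4 ⊢
    rw [h2]
    have := hpA (k + j + k)
    have := hps (k + (j + l))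
    have := hf j
    have := hf l
    have := hf (j + l)
    generalize poch (1 + A + 2 * k + j) l = X at h4 ⊢
    field_simp
  rw [Finset.sum_congr rfl step, ← Finset.mul_sum, sa]
  have h1 := poch_neg_nat (show k ≤ k + N by omega)
  rw [show k + N - k = N by omega] at h1
  have h2 : poch (1 + A - -((k + N : ℕ) : ℂ)) k * poch (1 + A) (k + N) =
      poch (1 + A) (2 * k + N) := by
    rw [show 2 * k + N = (k + N) + k by omega, poch_add (1 + A) (k + N), sub_neg_eq_add]
    ring
  have h3 : poch (1 + A - -((k + N : ℕ) : ℂ)) k ≠ 0 := left_ne_zero_of_mul (h2 ▸ hpA _)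
  rw [show 1 + A + 2 * k - (D + k) = 1 + A - D + k by ring,
    show 1 + A + 2 * k - (E + k) = 1 + A - E + k by ring, ← h2, poch_add (1 + A - D),
    poch_add (1 + A - E)]
  have h4 : poch (-((k + N : ℕ) : ℂ)) k = (-1) ^ k * (k + N).factorial / N.factorial := by
    rw [eq_div_iff (hf N), h1]
  have h5 : ((-1 : ℂ)) ^ k * (-1) ^ k = 1 := by rw [← mul_pow]; simp
  rw [h4]
  have := hpA (k + N)
  have := hps (k + N)
  have := hf N
  field_simp
  linear_combination (-(poch D k * poch E k * α k * (k + N).factorial * poch (1 + A - D + k) N *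
    poch (1 + A - E + k) N)) * h5

/-- The coefficients of the very-well-poised series with the additional quadratic factor
`(k ^ 2 + A k + P) / P`. -/
noncomputable def quadPoised (A B C P : ℂ) (k : ℕ) : ℂ :=
  (-1) ^ k * (poch A k * ((A + 2 * k) / A) * (poch B k * poch C k) * ((k * (k + A) + P) / P)) /
    (poch (1 + A - B) k * poch (1 + A - C) k * k.factorial)

/-- The two well-poised sums give, for `m ≥ 1`, `(1+A-B-C)_{m-1}` times `P (A-B-C+m) - m B C`. By
`h` this linear polynomial equals `P (A-B-C)(G+m)/G`. -/
theorem sum_quadPoised (A B C G P : ℂ) (hA : ∀ k : ℕ, A + k ≠ 0) (hG : G ≠ 0) (hP : P ≠ 0)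
    (h : P * (A - B - C - G) = -(G * B * C)) (m : ℕ) (hB : ∀ k < m, 1 + A - B + (k : ℂ) ≠ 0)
    (hC : ∀ k < m, 1 + A - C + (k : ℂ) ≠ 0) :
    ∑ k ∈ Finset.range (m + 1), quadPoised A B C P k / ((m - k).factorial * poch (1 + A) (m + k)) =
      poch (A - B - C) m * ((G + m) / G) /
        (poch (1 + A - B) m * poch (1 + A - C) m * m.factorial) := by
  have hf : ∀ m : ℕ, (m.factorial : ℂ) ≠ 0 := fun m => by exact_mod_cast Nat.factorial_ne_zero _
  have hA0 : A ≠ 0 := by simpa using hA 0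
  have hpA : ∀ k, poch A k ≠ 0 := fun m => poch_ne_zero fun j _ => hA j
  have hB' : poch (1 + A - B) m ≠ 0 := poch_ne_zero hB
  have hC' : poch (1 + A - C) m ≠ 0 := poch_ne_zero hC
  have step : ∀ k ∈ Finset.range (m + 1),
      quadPoised A B C P k / ((m - k).factorial * poch (1 + A) (m + k)) =
      ((m.choose k : ℂ) * ((A + 2 * k) / poch (A + k) (m + 1) * wellPoisedTerm A B C k (m - k)) *
        (k * (k + A)) +
      P * ((m.choose k : ℂ) * ((A + 2 * k) / poch (A + k) (m + 1) *
        wellPoisedTerm A B C k (m - k)))) /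
        (P * (poch (1 + A - B) m * poch (1 + A - C) m * m.factorial)) := by
    intro k hk
    obtain ⟨l, rfl⟩ := Nat.exists_eq_add_of_le (Nat.lt_succ_iff.1 (Finset.mem_range.1 hk))
    have h1 : poch A k * poch (A + k) (k + l + 1) = A * poch (1 + A) (k + l + k) := by
      rw [← poch_add, add_comm 1 A, ← poch_succ_left]
      congr 1
      omega
    have h1' : poch (A + k) (k + l + 1) ≠ 0 := poch_ne_zero fun i _ => by
      simpa [add_assoc] using hA (k + i)
    have h1'' : poch (1 + A) (k + l + k) ≠ 0 :=
      right_ne_zero_of_mul (h1 ▸ mul_ne_zero (hpA k) h1')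
    have h2 : ((k + l).choose k : ℂ) = (k + l).factorial / (k.factorial * l.factorial) := Nat.cast_add_choose ℂ
    rw [poch_add] at hB' hC'
    have b1 := left_ne_zero_of_mul hB'
    have b2 := right_ne_zero_of_mul hB'
    have c1 := left_ne_zero_of_mul hC'
    have c2 := right_ne_zero_of_mul hC'
    rw [show k + l - k = l by omega, h2, quadPoised, wellPoisedTerm, poch_add (1 + A - B),
      poch_add (1 + A - C)]
    have := hf k
    have := hf l
    have := hf (k + l)
    have h3 : poch A k = A * poch (1 + A) (k + l + k) / poch (A + k) (k + l + 1) := by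
      rw [eq_div_iff h1', h1]
    rw [h3]
    field_simp
  rw [Finset.sum_congr rfl step, ← Finset.sum_div, Finset.sum_add_distrib, ← Finset.mul_sum,
    sum_wellPoised m A B C hA]
  rcases m with _ | m
  · simp
    field_simp
  · rw [sum_wellPoised_weighted m A B C hA, show 1 + A - B - C = A - B - C + 1 by ring,
      poch_succ _ m, poch_succ_left (A - B - C)]
    have := hf (m + 1)
    field_simp
    push_cast
    linear_combination (-((m : ℂ) + 1) * poch (A - B - C + 1) m) * h

lemma poch_add_one_div {x : ℂ} (k : ℕ) (hx : x ≠ 0) :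
    poch (x + 1) k = poch x k * ((x + k) / x) := by
  have h1 := poch_succ x k
  rw [poch_succ_left] at h1
  field_simp
  exact h1

/-- The terminating transformation, with the Gamma quotient written with rising factorials. -/
theorem terminating_transformation (A B C D E G ω : ℂ) (hκ : A - B - C - G ≠ 0)
    (hω : ω ^ 2 = G * B * C / (A - B - C - G) + A ^ 2 / 4) (n : ℕ)
    (h1 : LowerNonzero [1 + A - B, 1 + A - C, D + E + -(n : ℂ) - A, G] n)
    (h2 : LowerNonzero [A / 2, 1 + A - B, 1 + A - C, 1 + A - D, 1 + A - E, 1 + A - -(n : ℂ),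
        A / 2 - ω, A / 2 + ω] n)
    (hA : ¬ IsNonposInt (A + 1)) (hs : ¬ IsNonposInt (1 + A - D - E)) :
    ∑ k ∈ Finset.range (n + 1), hypTerm [A - B - C, D, E, -(n : ℂ), G + 1]
        [1 + A - B, 1 + A - C, D + E + -(n : ℂ) - A, G] 1 k =
    poch (1 + A - D) n * poch (1 + A - E) n / (poch (1 + A) n * poch (1 + A - D - E) n) *
      ∑ k ∈ Finset.range (n + 1),
        hypTerm [A, 1 + A / 2, B, C, D, E, -(n : ℂ), A / 2 - ω + 1, A / 2 + ω + 1]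
          [A / 2, 1 + A - B, 1 + A - C, 1 + A - D, 1 + A - E, 1 + A - -(n : ℂ),
            A / 2 - ω, A / 2 + ω] 1 k := by
  -- For `n = 0` the conditions on lower parameters are empty, so `A`, `G` or `A/2 ± ω` may vanish;
  -- both sums are then their first term `1`.
  rcases n.eq_zero_or_pos with rfl | hn
  · simp [hypTerm]
  simp only [LowerNonzero, List.mem_cons, List.not_mem_nil, or_false, forall_eq_or_imp,
    forall_eq] at h1 h2
  obtain ⟨hB, hC, -, hG⟩ := h1
  obtain ⟨hA2, -, -, hD, hE, -, hw1, hw2⟩ := h2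
  have hA0 : A ≠ 0 := by
    have := hA2 0 hn
    intro h
    simp [h] at this
  have hA1 : ∀ k : ℕ, 1 + A + k ≠ 0 := fun k hk => hA ⟨k, by linear_combination hk⟩
  have hAk : ∀ k : ℕ, A + k ≠ 0 := by
    rintro (_ | k)
    · simpa using hA0
    · have := hA1 k
      push_cast
      rwa [show A + ((k : ℂ) + 1) = 1 + A + k by ring]
  have hs' : ∀ k : ℕ, 1 + A - D - E + k ≠ 0 := fun k hk => hs ⟨k, by linear_combination hk⟩
  have hG0 : G ≠ 0 := by simpa using hG 0 hn
  have hw10 : A / 2 - ω ≠ 0 := by simpa using hw1 0 hn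
  have hw20 : A / 2 + ω ≠ 0 := by simpa using hw2 0 hn
  have hPκ : (A / 2 - ω) * (A / 2 + ω) * (A - B - C - G) = -(G * B * C) := by
    field_simp at hω
    linear_combination (-1 / 4 : ℂ) * hω
  have hf : ∀ m : ℕ, (m.factorial : ℂ) ≠ 0 := fun m => by exact_mod_cast Nat.factorial_ne_zero _
  have key := bailey_transform A D E n (quadPoised A B C ((A / 2 - ω) * (A / 2 + ω))) hA1 hs' hD hE
  have L : ∀ m ∈ Finset.range (n + 1), hypTerm [A - B - C, D, E, -(n : ℂ), G + 1]
      [1 + A - B, 1 + A - C, D + E + -(n : ℂ) - A, G] 1 m =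
      poch D m * poch E m * (poch (-(n : ℂ)) m / poch (D + E + -(n : ℂ) - A) m) *
        ∑ k ∈ Finset.range (m + 1), quadPoised A B C ((A / 2 - ω) * (A / 2 + ω)) k /
          ((m - k).factorial * poch (1 + A) (m + k)) := by
    intro m hm
    have hm : m ≤ n := Nat.lt_succ_iff.1 (Finset.mem_range.1 hm)
    rw [sum_quadPoised A B C G _ hAk hG0 (mul_ne_zero hw10 hw20) hPκ m
      (fun k hk => hB k (by omega)) (fun k hk => hC k (by omega))]
    have hGm : poch G m ≠ 0 := poch_ne_zero fun k hk => hG k (by omega)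
    have e := poch_add_one_div m hG0
    simp only [hypTerm, List.map_cons, List.map_nil, List.prod_cons, List.prod_nil, mul_one,
      one_pow, ← poch.eq_def, e]
    field_simp
  have R : ∀ k ∈ Finset.range (n + 1),
      hypTerm [A, 1 + A / 2, B, C, D, E, -(n : ℂ), A / 2 - ω + 1, A / 2 + ω + 1]
          [A / 2, 1 + A - B, 1 + A - C, 1 + A - D, 1 + A - E, 1 + A - -(n : ℂ),
            A / 2 - ω, A / 2 + ω] 1 k =
      poch D k * poch E k * poch (-(n : ℂ)) k * (-1) ^ k /
        (poch (1 + A - D) k * poch (1 + A - E) k * poch (1 + A - -(n : ℂ)) k) *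
        quadPoised A B C ((A / 2 - ω) * (A / 2 + ω)) k := by
    intro k hk
    have hk : k ≤ n := Nat.lt_succ_iff.1 (Finset.mem_range.1 hk)
    have p1 : poch (A / 2) k ≠ 0 := poch_ne_zero fun j hj => hA2 j (by omega)
    have p2 : poch (A / 2 - ω) k ≠ 0 := poch_ne_zero fun j hj => hw1 j (by omega)
    have p3 : poch (A / 2 + ω) k ≠ 0 := poch_ne_zero fun j hj => hw2 j (by omega)
    have e1 := poch_add_one_div k (div_ne_zero hA0 two_ne_zero)
    have e2 := poch_add_one_div k hw10
    have e3 := poch_add_one_div k hw20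
    have e4 : (A / 2 + k) / (A / 2) = (A + 2 * k) / A := by field_simp
    have e5 : (k : ℂ) * (k + A) + (A / 2 - ω) * (A / 2 + ω) =
      (A / 2 - ω + k) * (A / 2 + ω + k) := by ring
    have h5 : ((-1 : ℂ)) ^ k * (-1) ^ k = 1 := by rw [← mul_pow]; simp
    rw [e4] at e1
    simp only [hypTerm, List.map_cons, List.map_nil, List.prod_cons, List.prod_nil, mul_one,
      one_pow, ← poch.eq_def, quadPoised, e5]
    rw [add_comm 1 (A / 2), e1, e2, e3]
    have e6 : ∀ x y z : ℂ, x * (-1) ^ k / y * ((-1) ^ k * z) = x / y * z := fun x y z => by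
      linear_combination (x / y * z) * h5
    rw [mul_div_assoc ((-1) ^ k), e6]
    generalize poch (A / 2) k = x1 at p1 ⊢
    generalize poch (A / 2 - ω) k = x2 at p2 ⊢
    generalize poch (A / 2 + ω) k = x3 at p3 ⊢
    generalize poch A k = y1
    generalize poch B k = y2
    generalize poch C k = y3
    generalize poch D k = y4
    generalize poch E k = y5
    generalize poch (-(n : ℂ)) k = y6
    generalize poch (1 + A - B) k = z2
    generalize poch (1 + A - C) k = z3
    generalize poch (1 + A - D) k = z4
    generalize poch (1 + A - E) k = z5
    generalize poch (1 + A - -(n : ℂ)) k = z6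
    generalize (k.factorial : ℂ) = z7
    generalize (A + 2 * k) / A = u
    generalize A / 2 - ω + k = u1
    generalize A / 2 + ω + k = u2
    generalize A / 2 - ω = v1
    generalize A / 2 + ω = v2
    -- Only `(A/2)_k` and `(A/2 ∓ ω)_k` are cancelled, so only they need to be nonzero; the rest
    -- matches formally.
    have cancel : y1 * (x1 * u * (y2 * (y3 * (y4 * (y5 * (y6 * (x2 * (u1 / v1) *
        (x3 * (u2 / v2))))))))) / (x1 * (z2 * (z3 * (z4 * (z5 * (z6 * (x2 * x3))))))) =
        x1 * x2 * x3 * (y1 * u * y2 * y3 * y4 * y5 * y6 * (u1 / v1) * (u2 / v2)) /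
          (x1 * x2 * x3 * (z2 * z3 * z4 * z5 * z6)) := by
      congr 1 <;> ring
    rw [cancel, mul_div_mul_left _ _ (mul_ne_zero (mul_ne_zero p1 p2) p3)]
    simp only [div_eq_mul_inv, mul_inv]
    ring
  rw [Finset.sum_congr rfl L, key, Finset.sum_congr rfl R]

/-! ### Growth of the terms and of their differences -/

lemma poch_ne_zero_of_not_isNonposInt {x : ℂ} (hx : ¬ IsNonposInt x) (k : ℕ) : poch x k ≠ 0 :=
  poch_ne_zero fun j _ h => hx ⟨j, by linear_combination h⟩

/-- This is Euler's limit `k^x k! / (x)_{k+1} → Γ(x)`, inverted. It explains the index `k + 1` in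
the estimates below. -/
lemma tendsto_poch_div {x : ℂ} (hx : ¬ IsNonposInt x) :
    Tendsto (fun k : ℕ => poch x (k + 1) / ((k : ℂ) ^ x * k.factorial)) atTop
      (𝓝 (Complex.Gamma x)⁻¹) := by
  have h0 : Complex.Gamma x ≠ 0 := Complex.Gamma_ne_zero fun m hm => hx ⟨m, hm⟩
  refine ((Complex.GammaSeq_tendsto_Gamma x).inv₀ h0).congr fun k => ?_
  rw [Complex.GammaSeq, inv_div, poch_eq_prod]

lemma rpow_succ_isTheta (p : ℝ) :
    (fun k : ℕ => (k : ℝ) ^ p) =Θ[atTop] fun k : ℕ => ((k : ℝ) + 1) ^ p := by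
  refine (isTheta_of_div_tendsto_nhds_ne_zero (c := 1) ?_ one_ne_zero).symm
  have h := (tendsto_natCast_div_add_atTop (1 : ℝ)).rpow_const (p := p) (Or.inl one_ne_zero)
  rw [Real.one_rpow] at h
  exact h.congr fun k => Real.div_rpow (by positivity) (by positivity) p

lemma poch_isTheta {x : ℂ} (hx : ¬ IsNonposInt x) :
    (fun k : ℕ => poch x (k + 1)) =Θ[atTop]
      fun k : ℕ => ((k : ℝ) + 1) ^ x.re * k.factorial := by
  have h0 : Complex.Gamma x ≠ 0 := Complex.Gamma_ne_zero fun m hm => hx ⟨m, hm⟩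
  have h1 := isTheta_of_div_tendsto_nhds_ne_zero (tendsto_poch_div hx) (inv_ne_zero h0)
  have h2 : (fun k : ℕ => (k : ℂ) ^ x) =Θ[atTop] fun k : ℕ => (k : ℝ) ^ x.re := by
    refine IsTheta.of_norm_eventuallyEq_norm ?_
    filter_upwards [eventually_gt_atTop 0] with k hk
    rw [Complex.norm_natCast_cpow_of_pos hk, Real.norm_of_nonneg (by positivity)]
  have h3 : (fun k : ℕ => (k.factorial : ℂ)) =Θ[atTop] fun k : ℕ => (k.factorial : ℝ) :=
    IsTheta.of_norm_eventuallyEq_norm (Eventually.of_forall fun k => by simp)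
  exact h1.symm.trans ((h2.trans (rpow_succ_isTheta _)).mul h3)

/-- An upper parameter may be a non-positive integer; its symbol then vanishes eventually, so only
the upper bound survives. -/
lemma poch_isBigO (x : ℂ) :
    (fun k : ℕ => poch x (k + 1)) =O[atTop]
      fun k : ℕ => ((k : ℝ) + 1) ^ x.re * k.factorial := by
  by_cases hx : IsNonposInt x
  · obtain ⟨m, rfl⟩ := hx
    refine EventuallyEq.trans_isBigO ?_ (isBigO_zero _ _)
    filter_upwards [eventually_ge_atTop m] with k hk
    exact poch_neg_nat_eq_zero (by omega)
  · exact (poch_isTheta hx).1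

lemma prod_poch_isBigO (a : List ℂ) :
    (fun k : ℕ => (a.map fun x => poch x (k + 1)).prod) =O[atTop]
      fun k : ℕ => ((k : ℝ) + 1) ^ a.sum.re * (k.factorial : ℝ) ^ a.length := by
  induction a with
  | nil => simpa using isBigO_refl (fun _ : ℕ => (1 : ℝ)) atTop
  | cons x a ih =>
    simp only [List.map_cons, List.prod_cons, List.sum_cons, List.length_cons, Complex.add_re]
    refine ((poch_isBigO x).mul ih).congr_right fun k => ?_
    rw [Real.rpow_add (by positivity), pow_succ]
    ring

lemma prod_poch_isTheta (b : List ℂ) (hb : ∀ x ∈ b, ¬ IsNonposInt x) :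
    (fun k : ℕ => (b.map fun x => poch x (k + 1)).prod) =Θ[atTop]
      fun k : ℕ => ((k : ℝ) + 1) ^ b.sum.re * (k.factorial : ℝ) ^ b.length := by
  induction b with
  | nil => simp
  | cons x b ih =>
    simp only [List.map_cons, List.prod_cons, List.sum_cons, List.length_cons, Complex.add_re]
    have h := (poch_isTheta (hb x (by simp))).mul (ih fun y hy => hb y (by simp [hy]))
    refine h.trans (EventuallyEq.isTheta (Eventually.of_forall fun k => ?_))
    simp only [Real.rpow_add (show (0 : ℝ) < k + 1 by positivity), pow_succ]
    ring

/-- The size of the terms of a balanced-order hypergeometric series on the unit circle. -/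
lemma hypTerm_isBigO (a b : List ℂ) (z : ℂ) (hz : ‖z‖ = 1) (hb : ∀ x ∈ b, ¬ IsNonposInt x)
    (hl : a.length = b.length + 1) :
    (fun k : ℕ => hypTerm a b z (k + 1)) =O[atTop]
      fun k : ℕ => ((k : ℝ) + 1) ^ ((a.sum - b.sum).re - 1) := by
  have h1 := prod_poch_isBigO a
  have h2 := (prod_poch_isTheta b hb).inv.1
  have h3 : (fun k : ℕ => z ^ (k + 1)) =O[atTop] fun _ : ℕ => (1 : ℝ) :=
    isBigO_of_le _ fun k => by simp [hz]
  have h4 : (fun k : ℕ => (((k + 1).factorial : ℂ))⁻¹) =O[atTop]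
      fun k : ℕ => (((k + 1).factorial : ℝ))⁻¹ := isBigO_of_le _ fun k => by simp
  refine (((h1.mul h2).mul h3).mul h4).congr (fun k => by simp [hypTerm, poch, div_eq_mul_inv])
    fun k => ?_
  have hk : (0 : ℝ) < k + 1 := by positivity
  have hf : (0 : ℝ) < k.factorial := by positivity
  rw [hl, Complex.sub_re, Real.rpow_sub hk, Real.rpow_sub hk, Real.rpow_one, Nat.factorial_succ]
  have := Real.rpow_pos_of_pos hk b.sum.re
  push_cast
  field_simp
  ring

lemma exists_bound_hypTerm (a b : List ℂ) (z : ℂ) (hz : ‖z‖ = 1)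
    (hb : ∀ x ∈ b, ¬ IsNonposInt x) (hl : a.length = b.length + 1) :
    ∃ K : ℝ, 0 < K ∧ ∀ k : ℕ, ‖hypTerm a b z k‖ ≤ K * ((k : ℝ) + 1) ^ ((a.sum - b.sum).re - 1) := by
  have h' : (fun k : ℕ => hypTerm a b z (k + 1)) =O[atTop]
      fun k : ℕ => (fun k : ℕ => ((k : ℝ) + 1) ^ ((a.sum - b.sum).re - 1)) (k + 1) := by
    refine (hypTerm_isBigO a b z hz hb hl).trans ?_
    have := (rpow_succ_isTheta ((a.sum - b.sum).re - 1)).1.comp_tendsto (tendsto_add_atTop_nat 1)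
    refine this.congr (fun k => ?_) fun k => ?_ <;> simp
  have h2 : (fun k : ℕ => hypTerm a b z k) =O[atTop]
      fun k : ℕ => ((k : ℝ) + 1) ^ ((a.sum - b.sum).re - 1) := by
    obtain ⟨c, hc⟩ := h'.bound
    refine IsBigO.of_bound c ?_
    obtain ⟨N, hN⟩ := eventually_atTop.1 hc
    filter_upwards [eventually_ge_atTop (N + 1)] with k hk
    obtain ⟨l, rfl⟩ := Nat.exists_eq_add_of_le' (show 1 ≤ k by omega)
    exact hN l (by omega)
  obtain ⟨K, hK, hb⟩ := bound_of_isBigO_nat_atTop h2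
  refine ⟨K, hK, fun k => ?_⟩
  have hp : (0 : ℝ) < ((k : ℝ) + 1) ^ ((a.sum - b.sum).re - 1) := by positivity
  have := hb hp.ne'
  rwa [Real.norm_of_nonneg hp.le] at this

lemma sub_one_isBigO_mul {f g : ℕ → ℂ} {h : ℕ → ℝ} (hh : Tendsto h atTop (𝓝 0))
    (hf : (fun k => f k - 1) =O[atTop] h) (hg : (fun k => g k - 1) =O[atTop] h) :
    (fun k => f k * g k - 1) =O[atTop] h := by
  have h1 : g =O[atTop] fun _ => (1 : ℝ) := by
    have := (hg.trans (hh.isBigO_one ℝ)).add (isBigO_const_const (1 : ℂ) one_ne_zero atTop)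
    exact this.congr_left fun k => by ring
  have := ((hf.mul h1).congr_right (fun k => mul_one _)).add hg
  exact this.congr_left fun k => by ring

lemma tendsto_inv_succ : Tendsto (fun k : ℕ => ((k : ℝ) + 1)⁻¹) atTop (𝓝 0) := by
  simpa using tendsto_one_div_add_atTop_nhds_zero_nat (𝕜 := ℝ)

lemma add_div_succ_sub_one_isBigO (x : ℂ) :
    (fun k : ℕ => (x + k) / ((k : ℂ) + 1) - 1) =O[atTop] fun k : ℕ => ((k : ℝ) + 1)⁻¹ := by
  refine IsBigO.of_bound ‖x - 1‖ (Eventually.of_forall fun k => ?_)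
  have h : (k : ℂ) + 1 ≠ 0 := by exact_mod_cast Nat.succ_ne_zero k
  have h2 : ‖(k : ℂ) + 1‖ = (k : ℝ) + 1 := by
    rw [show (k : ℂ) + 1 = ((k + 1 : ℕ) : ℂ) by push_cast; rfl, Complex.norm_natCast]
    push_cast; rfl
  rw [show (x + k) / ((k : ℂ) + 1) - 1 = (x - 1) / (k + 1) by field_simp; ring, norm_div, h2,
    Real.norm_of_nonneg (by positivity), div_eq_mul_inv]

lemma inv_sub_one_isBigO {f : ℕ → ℂ} {h : ℕ → ℝ} (hh : Tendsto h atTop (𝓝 0))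
    (hf : (fun k => f k - 1) =O[atTop] h) : (fun k => (f k)⁻¹ - 1) =O[atTop] h := by
  have h1 : Tendsto f atTop (𝓝 1) := by
    have := (hf.trans_tendsto hh).add_const 1
    simpa using this
  have h2 := (h1.inv₀ one_ne_zero).isBigO_one ℝ
  have h3 := ((hf.neg_left.mul h2).congr_right fun k => mul_one _)
  refine h3.congr' ?_ EventuallyEq.rfl
  filter_upwards [h1.eventually_ne one_ne_zero] with k hk
  field_simp
  ring

lemma prod_add_sub_one_isBigO (a : List ℂ) :
    (fun k : ℕ => (a.map fun x => (x + k) / ((k : ℂ) + 1)).prod - 1) =O[atTop]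
      fun k : ℕ => ((k : ℝ) + 1)⁻¹ := by
  induction a with
  | nil => simpa using isBigO_zero _ _
  | cons x a ih =>
    simp only [List.map_cons, List.prod_cons]
    exact sub_one_isBigO_mul tendsto_inv_succ (add_div_succ_sub_one_isBigO x) ih

lemma prod_map_add (a : List ℂ) (k : ℕ) :
    (a.map fun x => x + (k : ℂ)).prod =
      (a.map fun x => (x + k) / ((k : ℂ) + 1)).prod * ((k : ℂ) + 1) ^ a.length := by
  have h : (k : ℂ) + 1 ≠ 0 := by exact_mod_cast Nat.succ_ne_zero k
  induction a with
  | nil => simp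
  | cons x a ih =>
    simp only [List.map_cons, List.prod_cons, List.length_cons, ih, pow_succ]
    field_simp

lemma hypTerm_succ (a b : List ℂ) (hl : a.length = b.length + 1) (k : ℕ) :
    hypTerm a b 1 (k + 1) = hypTerm a b 1 k *
      ((a.map fun x => (x + k) / ((k : ℂ) + 1)).prod *
        ((b.map fun x => (x + k) / ((k : ℂ) + 1)).prod)⁻¹) := by
  have h : (k : ℂ) + 1 ≠ 0 := by exact_mod_cast Nat.succ_ne_zero k
  have e : ∀ l : List ℂ, (l.map fun x => poch x (k + 1)).prod =
      (l.map fun x => poch x k).prod * (l.map fun x => x + (k : ℂ)).prod := fun l => by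
    simp [poch_succ, List.prod_map_mul]
  simp only [hypTerm, ← poch.eq_def, e, prod_map_add, hl, one_pow, mul_one, Nat.factorial_succ]
  push_cast
  rw [pow_succ]
  field_simp

/-- The ratio of consecutive terms is `1 + O(1/(k+1))`, so differencing gains one power of `k + 1`.
This is what makes the paired terms of the alternating series summable. -/
lemma exists_bound_hypTerm_sub (a b : List ℂ) (hb : ∀ x ∈ b, ¬ IsNonposInt x)
    (hl : a.length = b.length + 1) :
    ∃ K : ℝ, 0 < K ∧ ∀ k : ℕ, ‖hypTerm a b 1 (k + 1) - hypTerm a b 1 k‖ ≤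
      K * ((k : ℝ) + 1) ^ ((a.sum - b.sum).re - 1 - 1) := by
  obtain ⟨K, hK, hbd⟩ := exists_bound_hypTerm a b 1 (by simp) hb hl
  have h1 := sub_one_isBigO_mul tendsto_inv_succ (prod_add_sub_one_isBigO a)
    (inv_sub_one_isBigO tendsto_inv_succ (prod_add_sub_one_isBigO b))
  obtain ⟨K', hK', hbd'⟩ := bound_of_isBigO_nat_atTop h1
  refine ⟨K * K', mul_pos hK hK', fun k => ?_⟩
  have hk : (0 : ℝ) < (k : ℝ) + 1 := by positivity
  have h2 := hbd' (inv_pos.2 hk).ne'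
  rw [Real.norm_of_nonneg (inv_pos.2 hk).le] at h2
  rw [hypTerm_succ a b hl, ← mul_sub_one, norm_mul, Real.rpow_sub_one hk.ne']
  calc _ ≤ (K * ((k : ℝ) + 1) ^ ((a.sum - b.sum).re - 1)) * (K' * ((k : ℝ) + 1)⁻¹) :=
        mul_le_mul (hbd k) h2 (norm_nonneg _) (by positivity)
    _ = _ := by ring

/-! ### Limits of sums whose terms depend on `n` -/

/-- An alternating series with null terms and summable differences converges. -/
lemma tendsto_alternating_sum {e : ℕ → ℂ} (h0 : Tendsto e atTop (𝓝 0))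
    (hs : Summable fun j : ℕ => e (2 * j) - e (2 * j + 1)) :
    Tendsto (fun N : ℕ => ∑ k ∈ Finset.range N, (-1) ^ k * e k) atTop
      (𝓝 (∑' j : ℕ, (e (2 * j) - e (2 * j + 1)))) := by
  have heven : ∀ J : ℕ, ∑ k ∈ Finset.range (2 * J), (-1) ^ k * e k =
      ∑ j ∈ Finset.range J, (e (2 * j) - e (2 * j + 1)) := by
    intro J
    induction J with
    | zero => simp
    | succ J ih =>
      rw [show 2 * (J + 1) = 2 * J + 1 + 1 by ring, Finset.sum_range_succ, Finset.sum_range_succ, ih,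
        Finset.sum_range_succ, pow_succ, pow_mul]
      simp
      ring
  have hdiv : Tendsto (fun N : ℕ => N / 2) atTop atTop := Nat.tendsto_div_const_atTop two_ne_zero
  have h1 := hs.hasSum.tendsto_sum_nat.comp hdiv
  have h2 : Tendsto (fun N : ℕ => ∑ k ∈ Finset.range N, (-1) ^ k * e k -
      ∑ j ∈ Finset.range (N / 2), (e (2 * j) - e (2 * j + 1))) atTop (𝓝 0) := by
    have h0' := (h0.comp (tendsto_sub_atTop_nat 1)).norm
    rw [norm_zero] at h0'
    refine squeeze_zero_norm (fun N => ?_) h0'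
    rw [← heven]
    rcases Nat.even_or_odd' N with ⟨J, rfl | rfl⟩
    · simp
    · rw [show (2 * J + 1) / 2 = J by omega, Finset.sum_range_succ, pow_mul]
      simp
  simpa using h2.add h1

lemma summable_rpow_succ {p : ℝ} (hp : p < -1) : Summable fun k : ℕ => ((k : ℝ) + 1) ^ p := by
  have := (summable_nat_add_iff 1).2 (Real.summable_nat_rpow.2 hp)
  simpa using this

lemma tendsto_rpow_succ {p : ℝ} (hp : p < 0) :
    Tendsto (fun k : ℕ => ((k : ℝ) + 1) ^ p) atTop (𝓝 0) := by
  have h := (tendsto_rpow_neg_atTop (neg_pos.2 hp)).comp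
    (tendsto_atTop_add_const_right atTop (1 : ℝ) tendsto_natCast_atTop_atTop)
  rw [neg_neg] at h
  exact h

/-- Passage to the limit in a conditionally convergent alternating series. -/
theorem tendsto_alternating_sum_mul {d : ℕ → ℂ} {q : ℕ → ℕ → ℂ} {p K L : ℝ} (hp : p < 0)
    (hd : ∀ k, ‖d k‖ ≤ K * ((k : ℝ) + 1) ^ p)
    (hd' : ∀ k, ‖d (k + 1) - d k‖ ≤ K * ((k : ℝ) + 1) ^ (p - 1))
    (hq1 : ∀ k, Tendsto (fun n => q n k) atTop (𝓝 1)) (hq0 : ∀ n k, n < k → q n k = 0)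
    (hq : ∀ᶠ n in atTop, ∀ k, ‖q n k‖ ≤ L)
    (hq' : ∀ᶠ n in atTop, ∀ k : ℕ, ‖q n (k + 1) - q n k‖ ≤ L * ((k : ℝ) + 1)⁻¹) :
    ∃ T : ℂ, Tendsto (fun N : ℕ => ∑ k ∈ Finset.range N, (-1) ^ k * d k) atTop (𝓝 T) ∧
      Tendsto (fun n : ℕ => ∑ k ∈ Finset.range (n + 1), (-1) ^ k * (d k * q n k)) atTop (𝓝 T) := by
  have hd0 : Tendsto d atTop (𝓝 0) := squeeze_zero_norm hd (by
    simpa using (tendsto_rpow_succ hp).const_mul K)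
  have hinj : Function.Injective fun j : ℕ => 2 * j := fun a b h => by simpa using h
  have hsum : Summable fun j : ℕ => K * (((2 * j : ℕ) : ℝ) + 1) ^ (p - 1) :=
    ((summable_rpow_succ (by linarith : p - 1 < -1)).comp_injective hinj).mul_left K
  refine ⟨∑' j : ℕ, (d (2 * j) - d (2 * j + 1)), tendsto_alternating_sum hd0
    (Summable.of_norm_bounded hsum fun j => by rw [norm_sub_rev]; exact hd' (2 * j)), ?_⟩
  -- Since `q n` vanishes beyond `n`, the finite sum is also an infinite series of pairs, to which
  -- dominated convergence applies.
  have hfin : ∀ n : ℕ, ∑ k ∈ Finset.range (n + 1), (-1) ^ k * (d k * q n k) =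
      ∑' j : ℕ, (d (2 * j) * q n (2 * j) - d (2 * j + 1) * q n (2 * j + 1)) := by
    intro n
    have h1 : Tendsto (fun k => d k * q n k) atTop (𝓝 0) :=
      tendsto_const_nhds.congr' (by
        filter_upwards [eventually_gt_atTop n] with k hk
        rw [hq0 n k hk, mul_zero])
    have h2 := tendsto_alternating_sum h1 (summable_of_ne_finset_zero (s := Finset.range (n + 1))
      fun j hj => by
        have : n < j := by simpa using hj
        rw [hq0 n _ (by omega), hq0 n _ (by omega), mul_zero, mul_zero, sub_zero])
    refine tendsto_nhds_unique (tendsto_const_nhds.congr' ?_) h2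
    filter_upwards [eventually_ge_atTop (n + 1)] with N hN
    refine Finset.sum_subset (Finset.range_mono hN) fun k _ hk => ?_
    have : n < k := by simpa using hk
    rw [hq0 n k this, mul_zero, mul_zero]
  simp_rw [hfin]
  refine tendsto_tsum_of_dominated_convergence (hsum.mul_left (2 * L)) (fun j => ?_) ?_
  · simpa using ((hq1 (2 * j)).const_mul (d (2 * j))).sub
      ((hq1 (2 * j + 1)).const_mul (d (2 * j + 1)))
  · filter_upwards [hq, hq'] with n h1 h2 j
    generalize 2 * j = k
    have hk : (0 : ℝ) < (k : ℝ) + 1 := by positivity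
    have hL : 0 ≤ L := (norm_nonneg _).trans (h1 0)
    -- Discrete product rule: each of the two products is at most `K * L * (k+1)^(p-1)`, uniformly
    -- in `n`.
    have e : d k * q n k - d (k + 1) * q n (k + 1) =
      -((d (k + 1) - d k) * q n (k + 1)) + -(d k * (q n (k + 1) - q n k)) := by ring
    rw [e]
    refine (norm_add_le _ _).trans ?_
    rw [norm_neg, norm_neg, norm_mul, norm_mul]
    have a1 := mul_le_mul (hd' k) (h1 (k + 1)) (norm_nonneg _) ((norm_nonneg _).trans (hd' k))
    have a2 := mul_le_mul (hd k) (h2 k) (norm_nonneg _) ((norm_nonneg _).trans (hd k))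
    have a3 : ((k : ℝ) + 1) ^ (p - 1) = ((k : ℝ) + 1) ^ p * ((k : ℝ) + 1)⁻¹ := by
      rw [Real.rpow_sub_one hk.ne', div_eq_mul_inv]
    rw [a3] at a1 ⊢
    linarith

/-- Passage to the limit under a uniform bound of the tails of finite sums. -/
theorem tendsto_sum_of_tail_bound {f : ℕ → ℕ → ℂ} {F : ℕ → ℂ} {t : ℕ → ℕ → ℝ} {T : ℕ → ℝ}
    (hF : Summable F) (hf : ∀ k, Tendsto (fun n => f n k) atTop (𝓝 (F k)))
    (ht : ∀ n K, 1 ≤ K → K ≤ n → ‖∑ k ∈ Finset.Ico K (n + 1), f n k‖ ≤ t n K)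
    (htT : ∀ K, Tendsto (fun n => t n K) atTop (𝓝 (T K))) (hT : Tendsto T atTop (𝓝 0)) :
    Tendsto (fun n : ℕ => ∑ k ∈ Finset.range (n + 1), f n k) atTop (𝓝 (∑' k, F k)) := by
  rw [Metric.tendsto_atTop']
  intro ε hε
  have h1 := (tendsto_order.1 hT).2 (ε / 3) (by positivity)
  have h2 := Metric.tendsto_nhds.1 hF.hasSum.tendsto_sum_nat (ε / 3) (by positivity)
  obtain ⟨K, hK1, hK2, hK⟩ := (h1.and (h2.and (eventually_ge_atTop 1))).exists
  have h3 := (tendsto_order.1 (htT K)).2 _ hK1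
  have h4 := Metric.tendsto_nhds.1 (tendsto_finsetSum (Finset.range K) fun k _ => hf k) (ε / 3)
    (by positivity)
  obtain ⟨N, hN⟩ := eventually_atTop.1 (h3.and (h4.and (eventually_ge_atTop K)))
  refine ⟨N, fun n hn => ?_⟩
  obtain ⟨a1, a2, a3⟩ := hN n hn.le
  have a4 := ht n K hK a3
  rw [← Finset.sum_range_add_sum_Ico _ (show K ≤ n + 1 by omega)]
  rw [dist_eq_norm] at a2 hK2 ⊢
  calc _ = ‖(∑ k ∈ Finset.range K, f n k - ∑ k ∈ Finset.range K, F k) +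
        (∑ k ∈ Finset.range K, F k - ∑' k, F k) + ∑ k ∈ Finset.Ico K (n + 1), f n k‖ := by
        congr 1; ring
    _ ≤ _ := norm_add₃_le
    _ < ε := by linarith

/-- Passage to the limit when only finitely many terms are nonzero. -/
lemma tendsto_sum_of_eventually_zero {c : ℕ → ℂ} {q : ℕ → ℕ → ℂ} {K : ℕ}
    (hc : ∀ k, K ≤ k → c k = 0) (hq1 : ∀ k, Tendsto (fun n => q n k) atTop (𝓝 1)) :
    ∃ T : ℂ, Tendsto (fun N : ℕ => ∑ k ∈ Finset.range N, c k) atTop (𝓝 T) ∧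
      Tendsto (fun n : ℕ => ∑ k ∈ Finset.range (n + 1), c k * q n k) atTop (𝓝 T) := by
  refine ⟨∑ k ∈ Finset.range K, c k, tendsto_const_nhds.congr' ?_, ?_⟩
  · filter_upwards [eventually_ge_atTop K] with N hN
    exact Finset.sum_subset (Finset.range_mono hN) fun k _ hk => hc k (by simpa using hk)
  · have h : Tendsto (fun n => ∑ k ∈ Finset.range K, c k * q n k) atTop
        (𝓝 (∑ k ∈ Finset.range K, c k)) := by
      simpa using tendsto_finsetSum (Finset.range K) fun k _ => (hq1 k).const_mul (c k)
    refine h.congr' ?_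
    filter_upwards [eventually_ge_atTop K] with n hn
    refine Finset.sum_subset (Finset.range_mono (by omega)) fun k _ hk => ?_
    rw [hc k (by simpa using hk), zero_mul]

lemma tendsto_sub_div_add (a c : ℂ) :
    Tendsto (fun n : ℕ => ((n : ℂ) - a) / (n + c)) atTop (𝓝 1) := by
  have h1 : Tendsto (fun n : ℕ => 1 - a * (n : ℂ)⁻¹) atTop (𝓝 1) := by
    simpa using ((tendsto_inv_atTop_nhds_zero_nat (𝕜 := ℂ)).const_mul a).const_sub 1
  have h2 := h1.mul (tendsto_natCast_div_add_atTop (𝕜 := ℂ) c)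
  rw [mul_one] at h2
  refine h2.congr' ?_
  filter_upwards [eventually_gt_atTop 0] with n hn
  have : (n : ℂ) ≠ 0 := by exact_mod_cast hn.ne'
  field_simp

/-! ### The two factors depending on `n` -/

/-- The factor `(-1)^k (-n)_k / (1 + A + n)_k`. -/
noncomputable def poisedFactor (A : ℂ) (n k : ℕ) : ℂ :=
  ∏ j ∈ Finset.range k, (((n : ℂ) - j) / (n + (1 + A + j)))

/-- The factor `(-n)_k / (1 - s - n)_k`. -/
noncomputable def saalschutzFactor (s : ℂ) (n k : ℕ) : ℂ :=
  ∏ j ∈ Finset.range k, (((n : ℂ) - j) / (n + (s - 1 - j)))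

lemma poisedFactor_eq (A : ℂ) (n k : ℕ) :
    poisedFactor A n k = (-1) ^ k * poch (-(n : ℂ)) k / poch (1 + A - -(n : ℂ)) k := by
  rw [poisedFactor, poch_eq_prod, poch_eq_prod, ← Finset.card_range k, ← Finset.prod_const,
    Finset.card_range, ← Finset.prod_mul_distrib, ← Finset.prod_div_distrib]
  refine Finset.prod_congr rfl fun j _ => ?_
  congr 1 <;> ring

lemma saalschutzFactor_eq (s : ℂ) (n k : ℕ) :
    saalschutzFactor s n k = poch (-(n : ℂ)) k / poch (1 - s - n) k := by
  rw [saalschutzFactor, poch_eq_prod, poch_eq_prod, ← Finset.prod_div_distrib]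
  refine Finset.prod_congr rfl fun j _ => ?_
  rw [← neg_div_neg_eq]
  congr 1 <;> ring

lemma tendsto_poisedFactor (A : ℂ) (k : ℕ) :
    Tendsto (fun n => poisedFactor A n k) atTop (𝓝 1) := by
  have := tendsto_finsetProd (Finset.range k) fun j _ => tendsto_sub_div_add (j : ℂ) (1 + A + j)
  simpa [poisedFactor, saalschutzFactor] using this

lemma tendsto_saalschutzFactor (s : ℂ) (k : ℕ) :
    Tendsto (fun n => saalschutzFactor s n k) atTop (𝓝 1) := by
  have := tendsto_finsetProd (Finset.range k) fun j _ => tendsto_sub_div_add (j : ℂ) (s - 1 - j)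
  simpa [poisedFactor, saalschutzFactor] using this

lemma poisedFactor_eq_zero (A : ℂ) {n k : ℕ} (h : n < k) : poisedFactor A n k = 0 :=
  Finset.prod_eq_zero (Finset.mem_range.2 h) (by simp)

lemma le_norm_poisedFactor_denom (A : ℂ) (n k : ℕ) :
    (n : ℝ) + k + 1 - ‖A‖ ≤ ‖(n : ℂ) + (1 + A + k)‖ := by
  have h := norm_sub_le_norm_add ((n + k + 1 : ℕ) : ℂ) A
  rw [Complex.norm_natCast] at h
  push_cast at h
  rwa [show (n : ℂ) + (1 + A + k) = n + k + 1 + A by ring]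

/-- Gaussian-type decay of the factors, uniform in `n`. -/
lemma norm_poisedFactor_mul_le (A : ℂ) :
    ∀ᶠ n : ℕ in atTop, ∀ k : ℕ, ‖poisedFactor A n k‖ * (n + (k : ℝ) ^ 2 / 2) ≤ 4 * n := by
  obtain ⟨M, hM⟩ := exists_nat_ge ‖A‖
  have h1 : ∀ᶠ n : ℕ in atTop, ∀ k ∈ Finset.range (M + 1), ‖poisedFactor A n k‖ < 2 := by
    rw [Filter.eventually_all_finset]
    intro k _
    have := (tendsto_poisedFactor A k).norm
    rw [norm_one] at this
    exact (tendsto_order.1 this).2 _ one_lt_two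
  filter_upwards [h1, eventually_ge_atTop (M ^ 2)] with n hn hnM k
  have hnM' : (M : ℝ) ^ 2 ≤ n := by exact_mod_cast hnM
  have hn0 : (0 : ℝ) ≤ n := Nat.cast_nonneg n
  rcases le_total k M with hk | hk
  · have h2 := (hn k (Finset.mem_range.2 (by omega))).le
    have hk' : (k : ℝ) ^ 2 ≤ (M : ℝ) ^ 2 := by gcongr
    calc _ ≤ 2 * (n + (n : ℝ) / 2) := by gcongr; exact hk'.trans hnM'
      _ ≤ 4 * n := by linarith
  -- From `k = M ≥ ‖A‖` on, the product `‖poisedFactor A n k‖ * (n + k^2/2)` does not increase with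
  -- `k`.
  · induction k, hk using Nat.le_induction with
    | base =>
      have h2 := (hn M (Finset.mem_range.2 (by omega))).le
      calc _ ≤ 2 * (n + (n : ℝ) / 2) := by gcongr
        _ ≤ 4 * n := by linarith
    | succ k hk ih =>
      rcases lt_or_ge n (k + 1) with h | h
      · rw [poisedFactor_eq_zero A h]
        simp
      · refine le_trans ?_ ih
        have hkM : (M : ℝ) ≤ k := by exact_mod_cast hk
        have hkn : (k : ℝ) + 1 ≤ n := by exact_mod_cast h
        have hk0 : (0 : ℝ) ≤ k := Nat.cast_nonneg k
        have hden := le_norm_poisedFactor_denom A n k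
        have hpos : 0 < (n : ℝ) + k + 1 - ‖A‖ := by linarith
        have hnum : ‖(n : ℂ) - k‖ = (n : ℝ) - k := by
          rw [← Nat.cast_sub (by omega), Complex.norm_natCast, Nat.cast_sub (by omega)]
        rw [poisedFactor, Finset.prod_range_succ, ← poisedFactor, norm_mul, norm_div, hnum, mul_assoc]
        refine mul_le_mul_of_nonneg_left ?_ (norm_nonneg _)
        rw [div_mul_eq_mul_div, div_le_iff₀ (hpos.trans_le hden)]
        refine le_trans ?_ (mul_le_mul_of_nonneg_left hden (by positivity))
        push_cast
        have b1 : 0 ≤ (n : ℝ) * (k - ‖A‖) := mul_nonneg hn0 (by linarith)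
        have b2 : 0 ≤ (k : ℝ) ^ 2 * (k - ‖A‖) := mul_nonneg (by positivity) (by linarith)
        have b3 : 0 ≤ (k : ℝ) ^ 3 := by positivity
        nlinarith

/-- The difference is the factor times `-(1+A+2k)/(n+1+A+k)`, of size `O((k+1)/n)`. Against the
decay `4n/(n + k^2/2)` this is `O(1/(k+1))`, because `(k+1)^2 ≤ 4(n + k^2/2)` for `n ≥ 1`; hence `32
= 8 * 4` in the constant. -/
lemma exists_bound_poisedFactor (A : ℂ) : ∃ L : ℝ,
    (∀ᶠ n : ℕ in atTop, ∀ k, ‖poisedFactor A n k‖ ≤ L) ∧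
    ∀ᶠ n : ℕ in atTop, ∀ k : ℕ,
      ‖poisedFactor A n (k + 1) - poisedFactor A n k‖ ≤ L * ((k : ℝ) + 1)⁻¹ := by
  obtain ⟨M, hM⟩ := exists_nat_ge ‖A‖
  refine ⟨32 * (‖A‖ + 2), ?_, ?_⟩
  · filter_upwards [norm_poisedFactor_mul_le A, eventually_gt_atTop 0] with n h hn k
    have hn0 : (0 : ℝ) < n := by exact_mod_cast hn
    have h1 : ‖poisedFactor A n k‖ * n ≤ 4 * n :=
      le_trans (mul_le_mul_of_nonneg_left (by linarith [sq_nonneg (k : ℝ)]) (norm_nonneg _)) (h k)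
    have h2 := le_of_mul_le_mul_right h1 hn0
    linarith [norm_nonneg A]
  · filter_upwards [norm_poisedFactor_mul_le A, eventually_gt_atTop 0, eventually_ge_atTop (2 * M)]
      with n h hn hnM k
    have hn0 : (1 : ℝ) ≤ n := by exact_mod_cast hn
    have hnM' : 2 * (M : ℝ) ≤ n := by exact_mod_cast hnM
    have hk0 : (0 : ℝ) ≤ k := Nat.cast_nonneg k
    have hden := le_norm_poisedFactor_denom A n k
    have hden' : (n : ℝ) / 2 ≤ ‖(n : ℂ) + (1 + A + k)‖ := by linarith
    have hpos : (0 : ℝ) < ‖(n : ℂ) + (1 + A + k)‖ := by linarith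
    have hne : (n : ℂ) + (1 + A + k) ≠ 0 := norm_pos_iff.1 hpos
    have e : poisedFactor A n (k + 1) - poisedFactor A n k =
        -(poisedFactor A n k * ((1 + A + 2 * k) / (n + (1 + A + k)))) := by
      rw [poisedFactor, Finset.prod_range_succ, ← poisedFactor]
      field_simp
      ring
    have hnum : ‖1 + A + 2 * (k : ℂ)‖ ≤ (‖A‖ + 2) * (k + 1) := by
      calc _ ≤ ‖(1 : ℂ)‖ + ‖A‖ + ‖2 * (k : ℂ)‖ := norm_add₃_le
        _ = 1 + ‖A‖ + 2 * k := by simp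
        _ ≤ _ := by nlinarith [norm_nonneg A]
    rw [e, norm_neg, norm_mul, norm_div, ← div_eq_mul_inv, le_div_iff₀ (by positivity)]
    have hX : 0 < n + (k : ℝ) ^ 2 / 2 := by positivity
    have h1 : ‖poisedFactor A n k‖ ≤ 4 * n / (n + (k : ℝ) ^ 2 / 2) := by
      rw [le_div_iff₀ hX]
      exact h k
    calc _ ≤ 4 * n / (n + (k : ℝ) ^ 2 / 2) * ((‖A‖ + 2) * (k + 1) / (n / 2)) * (k + 1) := by
          gcongr
      _ = 8 * (‖A‖ + 2) * (((k : ℝ) + 1) ^ 2 / (n + (k : ℝ) ^ 2 / 2)) := by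
          field_simp
          ring
      _ ≤ 8 * (‖A‖ + 2) * 4 := by
          gcongr
          rw [div_le_iff₀ hX]
          nlinarith [sq_nonneg ((k : ℝ) - 1)]
      _ = _ := by ring

/-- The majorant of the factors `saalschutzFactor s n k` for `σ ≤ re s`. -/
noncomputable def realFactor (σ : ℝ) (n k : ℕ) : ℝ :=
  ∏ j ∈ Finset.range k, (((n : ℝ) - j) / (n + (σ - 1 - j)))

/-- Each denominator is bounded below by its real part, which is positive for `j < n` because `σ >
0`. -/
lemma norm_saalschutzFactor_le {s : ℂ} {σ : ℝ} (h0 : 0 < σ) (h : σ ≤ s.re) {n k : ℕ} (hk : k ≤ n) :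
    ‖saalschutzFactor s n k‖ ≤ realFactor σ n k := by
  rw [saalschutzFactor, realFactor, norm_prod]
  refine Finset.prod_le_prod (fun _ _ => norm_nonneg _) fun j hj => ?_
  have hj : j + 1 ≤ n := by
    have := Finset.mem_range.1 hj
    omega
  have hj' : (j : ℝ) + 1 ≤ n := by exact_mod_cast hj
  rw [norm_div, ← Nat.cast_sub (by omega), Complex.norm_natCast, Nat.cast_sub (by omega)]
  have h1 := Complex.re_le_norm ((n : ℂ) + (s - 1 - j))
  simp only [Complex.add_re, Complex.sub_re, Complex.natCast_re, Complex.one_re] at h1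
  exact div_le_div_of_nonneg_left (by linarith) (by linarith) (by linarith)

/-- The coefficients of `(1 - x)^σ`, in absolute value. -/
noncomputable def binomCoeff (σ : ℝ) (k : ℕ) : ℝ := ‖poch (-(σ : ℂ)) k‖ / k.factorial

lemma binomCoeff_succ {σ : ℝ} (h1 : σ < 1) {k : ℕ} (hk : 1 ≤ k) :
    binomCoeff σ (k + 1) = binomCoeff σ k * ((k - σ) / (k + 1)) := by
  have hk' : (1 : ℝ) ≤ k := by exact_mod_cast hk
  have h2 : ‖-(σ : ℂ) + k‖ = k - σ := by
    rw [show -(σ : ℂ) + k = ((k - σ : ℝ) : ℂ) by push_cast; ring, Complex.norm_real,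
      Real.norm_of_nonneg (by linarith)]
  rw [binomCoeff, binomCoeff, poch_succ, norm_mul, h2, Nat.factorial_succ]
  push_cast
  field_simp

/-- The tails of the finite majorising sums, by telescoping. -/
lemma sum_Ico_binomCoeff_mul {σ : ℝ} (h0 : 0 < σ) (h1 : σ < 1) {n K : ℕ} (hK : 1 ≤ K)
    (hKn : K ≤ n) :
    ∑ k ∈ Finset.Ico K (n + 1), binomCoeff σ k * realFactor σ n k =
      K / σ * binomCoeff σ K * realFactor σ n K * ((n + (σ - K)) / n) := by
  obtain ⟨t, ht⟩ : ∃ t : ℕ → ℝ, ∀ k : ℕ,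
    t k = k / σ * binomCoeff σ k * realFactor σ n k * ((n + (σ - k)) / n) := ⟨_, fun _ => rfl⟩
  have step : ∀ k ∈ Finset.Ico K (n + 1),
      binomCoeff σ k * realFactor σ n k = (-t (k + 1)) - (-t k) := by
    intro k hk
    obtain ⟨hk1, hk2⟩ := Finset.mem_Ico.1 hk
    have hn : (n : ℝ) ≠ 0 := by
      have : n ≠ 0 := by omega
      exact_mod_cast this
    -- At the last index `k = n` the denominator is `σ - 1`; this is where `σ < 1` is needed.
    have hd : (n : ℝ) + (σ - 1 - k) ≠ 0 := by
      rcases (Nat.lt_succ_iff.1 hk2).lt_or_eq with h | rfl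
      · have : (k : ℝ) + 1 ≤ n := by exact_mod_cast h
        linarith
      · have : (k : ℝ) + (σ - 1 - k) = σ - 1 := by ring
        rw [this]
        linarith
    have hk0 : (k : ℝ) + 1 ≠ 0 := by positivity
    rw [ht, ht, binomCoeff_succ h1 (hK.trans hk1), realFactor, realFactor, Finset.prod_range_succ,
      ← realFactor]
    push_cast
    rw [show (n : ℝ) + (σ - (k + 1)) = n + (σ - 1 - k) by ring]
    field_simp
    ring
  have hz : realFactor σ n (n + 1) = 0 :=
    Finset.prod_eq_zero (Finset.mem_range.2 (Nat.lt_succ_self n)) (by simp)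
  rw [Finset.sum_congr rfl step, Finset.sum_Ico_sub (fun k => -t k) (by omega), ht, ht, hz]
  ring

lemma binomCoeff_succ_isTheta {σ : ℝ} (h0 : 0 < σ) (h1 : σ < 1) :
    (fun k : ℕ => binomCoeff σ (k + 1)) =Θ[atTop] fun k : ℕ => ((k : ℝ) + 1) ^ (-σ - 1) := by
  have hσ : ¬ IsNonposInt (-(σ : ℂ)) := by
    rintro ⟨m, hm⟩
    have hm' : σ = m := by exact_mod_cast neg_injective hm
    rcases m with _ | m
    · simp [hm'] at h0
    · rw [hm'] at h1
      push_cast at h1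
      linarith [(Nat.cast_nonneg m : (0 : ℝ) ≤ m)]
  have h2 := (poch_isTheta hσ).norm_left
  have h3 := h2.div (isTheta_refl (fun k : ℕ => ((k + 1).factorial : ℝ)) atTop)
  refine h3.trans (EventuallyEq.isTheta (Eventually.of_forall fun k => ?_))
  have hk : (0 : ℝ) < k + 1 := by positivity
  have hf : (0 : ℝ) < k.factorial := by positivity
  simp only [Complex.neg_re, Complex.ofReal_re, Nat.factorial_succ, Real.rpow_sub_one hk.ne']
  push_cast
  field_simp

/-- Passage to the limit in the Saalschützian series. -/
theorem tendsto_sum_mul_saalschutzFactor {c : ℕ → ℂ} {s : ℂ} {σ K : ℝ} (h0 : 0 < σ) (h1 : σ < 1)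
    (hs : σ ≤ s.re) (hK : 0 < K) (hc : ∀ k, ‖c k‖ ≤ K * ((k : ℝ) + 1) ^ (-σ - 1)) :
    ∃ T : ℂ, Tendsto (fun N : ℕ => ∑ k ∈ Finset.range N, c k) atTop (𝓝 T) ∧
      Tendsto (fun n : ℕ => ∑ k ∈ Finset.range (n + 1), c k * saalschutzFactor s n k) atTop
        (𝓝 T) := by
  have hsum : Summable c := Summable.of_norm_bounded
    ((summable_rpow_succ (by linarith : -σ - 1 < -1)).mul_left K) hc
  refine ⟨_, hsum.hasSum.tendsto_sum_nat, ?_⟩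
  have hb0 : ∀ k, 1 ≤ k → binomCoeff σ k ≠ 0 := by
    intro k hk
    refine div_ne_zero (norm_ne_zero_iff.2 (poch_ne_zero fun j _ h => ?_)) (by positivity)
    have h' : σ = j := by
      have : (σ : ℂ) = j := by linear_combination -h
      exact_mod_cast this
    rcases j with _ | j
    · simp [h'] at h0
    · rw [h'] at h1
      push_cast at h1
      linarith [(Nat.cast_nonneg j : (0 : ℝ) ≤ j)]
  have hbn : ∀ k, 0 ≤ binomCoeff σ k := fun k => by unfold binomCoeff; positivity
  obtain ⟨C, hC, hCb⟩ := bound_of_isBigO_nat_atTop (binomCoeff_succ_isTheta h0 h1).2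
  have hcb : ∀ k, 1 ≤ k → ‖c k‖ ≤ K * C * binomCoeff σ k := by
    intro k hk
    obtain ⟨l, rfl⟩ := Nat.exists_eq_add_of_le' hk
    have a1 := hCb (hb0 (l + 1) (by omega))
    rw [Real.norm_of_nonneg (by positivity), Real.norm_of_nonneg (hbn _)] at a1
    have a2 : (((l + 1 : ℕ) : ℝ) + 1) ^ (-σ - 1) ≤ ((l : ℝ) + 1) ^ (-σ - 1) :=
      Real.rpow_le_rpow_of_nonpos (by positivity) (by push_cast; linarith) (by linarith)
    calc _ ≤ K * (((l + 1 : ℕ) : ℝ) + 1) ^ (-σ - 1) := hc _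
      _ ≤ K * (C * binomCoeff σ (l + 1)) := by gcongr; exact a2.trans a1
      _ = _ := by ring
  have hρ : ∀ k, Tendsto (fun n => realFactor σ n k) atTop (𝓝 1) := by
    intro k
    have := (Complex.continuous_re.tendsto 1).comp (tendsto_saalschutzFactor (σ : ℂ) k)
    refine this.congr fun n => ?_
    have : saalschutzFactor (σ : ℂ) n k = ((realFactor σ n k : ℝ) : ℂ) := by
      simp only [saalschutzFactor, realFactor]
      push_cast
      rfl
    simp [this]
  have hlim : ∀ k : ℕ, Tendsto (fun n : ℕ => ((n : ℝ) + (σ - k)) / n) atTop (𝓝 1) := by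
    intro k
    have := (tendsto_natCast_div_add_atTop (𝕜 := ℝ) (σ - k)).inv₀ one_ne_zero
    simpa using this
  -- A majorant in `k` alone can fail: at `k = n` the real factor grows like `n^(1-σ)`, which for
  -- small `σ` destroys summability. The telescoped tail instead tends, as `n → ∞`, to a quantity of
  -- order `k^(-σ)`.
  refine tendsto_sum_of_tail_bound
    (t := fun n k => K * C * (k / σ * binomCoeff σ k * realFactor σ n k * ((n + (σ - k)) / n)))
    (T := fun k => K * C * (k / σ * binomCoeff σ k)) hsum
    (fun k => by simpa using (tendsto_saalschutzFactor s k).const_mul (c k)) ?_ ?_ ?_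
  · intro n k hk hkn
    rw [← sum_Ico_binomCoeff_mul h0 h1 hk hkn, Finset.mul_sum]
    refine norm_sum_le_of_le _ fun j hj => ?_
    obtain ⟨hj1, hj2⟩ := Finset.mem_Ico.1 hj
    rw [norm_mul, ← mul_assoc]
    exact mul_le_mul (hcb j (by omega)) (norm_saalschutzFactor_le h0 hs (by omega))
      (norm_nonneg _) (mul_nonneg (by positivity) (hbn j))
  · intro k
    have := (((hρ k).const_mul (k / σ * binomCoeff σ k)).mul (hlim k)).const_mul (K * C)
    simpa using this
  · have a1 : (fun k : ℕ => K * C * (((k + 1 : ℕ) : ℝ) / σ * binomCoeff σ (k + 1))) =O[atTop]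
        fun k : ℕ => ((k : ℝ) + 1) ^ (-σ) := by
      have b1 := ((isBigO_refl (fun k : ℕ => (k : ℝ) + 1) atTop).mul
        (binomCoeff_succ_isTheta h0 h1).1).const_mul_left (K * C / σ)
      refine b1.congr (fun k => ?_) fun k => ?_
      · push_cast
        ring
      · have hk : (0 : ℝ) < k + 1 := by positivity
        rw [Real.rpow_sub_one hk.ne']
        field_simp
    have a2 := a1.trans_tendsto (tendsto_rpow_succ (by linarith : -σ < 0))
    exact (tendsto_add_atTop_iff_nat 1).1 a2

/-! ### Terminating series and Gamma quotients -/

lemma hypTerm_eq_zero {a b : List ℂ} {z : ℂ} {m k : ℕ} (h : -(m : ℂ) ∈ a) (hk : m < k) :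
    hypTerm a b z k = 0 := by
  have : (a.map fun x => (ascPochhammer ℂ k).eval x).prod = 0 :=
    List.prod_eq_zero (List.mem_map.2 ⟨_, h, poch_neg_nat_eq_zero hk⟩)
  rw [hypTerm, this, zero_div, zero_mul, zero_div]

lemma hasHypSum_of_mem {a b : List ℂ} {z : ℂ} {m : ℕ} (h : -(m : ℂ) ∈ a) :
    HasHypSum a b z (∑ k ∈ Finset.range (m + 1), hypTerm a b z k) := by
  refine tendsto_const_nhds.congr' ?_
  filter_upwards [eventually_ge_atTop (m + 1)] with N hN
  exact Finset.sum_subset (Finset.range_mono hN) fun k _ hk =>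
    hypTerm_eq_zero h (by simpa using hk)

lemma Gamma_add_nat {x : ℂ} (hx : ¬ IsNonposInt x) (n : ℕ) :
    Complex.Gamma (x + n) = Complex.Gamma x * poch x n := by
  have h0 : Complex.Gamma x ≠ 0 := Complex.Gamma_ne_zero fun m hm => hx ⟨m, hm⟩
  rw [poch, ← Complex.Gamma_add_nat_div_Gamma_eq x fun m hm => hx ⟨m, hm⟩]
  field_simp

/-- Extends the nonvanishing of the first `n` factors to all factors; this supplies the conditions
on `1 + A - D` and `1 + A - E` in the terminating case. -/
lemma not_isNonposInt_of_add_nat {x : ℂ} {n : ℕ} (h : ∀ k < n, x + (k : ℂ) ≠ 0)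
    (hn : ¬ IsNonposInt (x + n)) : ¬ IsNonposInt x := by
  rintro ⟨m, hm⟩
  rcases lt_or_ge m n with hmn | hmn
  · exact h m hmn (by rw [hm]; ring)
  · exact hn ⟨m - n, by rw [hm, Nat.cast_sub hmn]; ring⟩

lemma gamma_quotient {A D E : ℂ} {n : ℕ} (hA : ¬ IsNonposInt (A + 1))
    (hs : ¬ IsNonposInt (1 + A - D - E)) (hD : ¬ IsNonposInt (1 + A - D))
    (hE : ¬ IsNonposInt (1 + A - E)) :
    Complex.Gamma (A + 1) * Complex.Gamma (1 + A - D - -(n : ℂ)) *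
        Complex.Gamma (1 + A - E - -(n : ℂ)) * Complex.Gamma (1 + A - D - E) /
      (Complex.Gamma (1 + A - -(n : ℂ)) * Complex.Gamma (1 + A - D) *
        Complex.Gamma (1 + A - E) * Complex.Gamma (1 + A - D - E - -(n : ℂ))) =
    poch (1 + A - D) n * poch (1 + A - E) n / (poch (1 + A) n * poch (1 + A - D - E) n) := by
  have h0 : ∀ {x : ℂ}, ¬ IsNonposInt x → Complex.Gamma x ≠ 0 := fun hx =>
    Complex.Gamma_ne_zero fun m hm => hx ⟨m, hm⟩
  rw [add_comm A 1] at hA ⊢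
  simp only [sub_neg_eq_add]
  rw [Gamma_add_nat hA, Gamma_add_nat hs, Gamma_add_nat hD, Gamma_add_nat hE]
  have := h0 hA
  have := h0 hs
  have := h0 hD
  have := h0 hE
  have := poch_ne_zero_of_not_isNonposInt hA n
  have := poch_ne_zero_of_not_isNonposInt hs n
  field_simp

/-- Euler's limit applies to each symbol; the powers of `k` cancel since `(1+A-D) + (1+A-E) = (1+A)
+ (1+A-D-E)`. -/
lemma tendsto_gamma_quotient {A D E : ℂ} (hA : ¬ IsNonposInt (A + 1))
    (hs : ¬ IsNonposInt (1 + A - D - E)) (hD : ¬ IsNonposInt (1 + A - D))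
    (hE : ¬ IsNonposInt (1 + A - E)) :
    Tendsto (fun n => poch (1 + A - D) n * poch (1 + A - E) n /
        (poch (1 + A) n * poch (1 + A - D - E) n)) atTop
      (𝓝 (Complex.Gamma (A + 1) * Complex.Gamma (1 + A - D - E) /
        (Complex.Gamma (1 + A - D) * Complex.Gamma (1 + A - E)))) := by
  have h0 : ∀ {x : ℂ}, ¬ IsNonposInt x → Complex.Gamma x ≠ 0 := fun hx =>
    Complex.Gamma_ne_zero fun m hm => hx ⟨m, hm⟩
  rw [add_comm A 1] at hA ⊢
  have h1 := ((tendsto_poch_div hD).mul (tendsto_poch_div hE)).div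
    ((tendsto_poch_div hA).mul (tendsto_poch_div hs))
    (mul_ne_zero (inv_ne_zero (h0 hA)) (inv_ne_zero (h0 hs)))
  have e : (Complex.Gamma (1 + A - D))⁻¹ * (Complex.Gamma (1 + A - E))⁻¹ /
      ((Complex.Gamma (1 + A))⁻¹ * (Complex.Gamma (1 + A - D - E))⁻¹) =
      Complex.Gamma (1 + A) * Complex.Gamma (1 + A - D - E) /
        (Complex.Gamma (1 + A - D) * Complex.Gamma (1 + A - E)) := by
    rw [← mul_inv, ← mul_inv, inv_div_inv]
  rw [e] at h1
  refine (tendsto_add_atTop_iff_nat 1).1 (h1.congr' ?_)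
  filter_upwards [eventually_gt_atTop 0] with k hk
  have hk' : (k : ℂ) ≠ 0 := by exact_mod_cast hk.ne'
  have hf : (k.factorial : ℂ) ≠ 0 := by exact_mod_cast Nat.factorial_ne_zero _
  have hpow : (k : ℂ) ^ (1 + A - D) * (k : ℂ) ^ (1 + A - E) =
      (k : ℂ) ^ (1 + A) * (k : ℂ) ^ (1 + A - D - E) := by
    rw [← Complex.cpow_add _ _ hk', ← Complex.cpow_add _ _ hk']
    congr 1
    ring
  have e1 : ∀ x : ℂ, (k : ℂ) ^ x ≠ 0 := fun x => by simp [Complex.cpow_eq_zero_iff, hk']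
  have p1 := poch_ne_zero_of_not_isNonposInt hA (k + 1)
  have p2 := poch_ne_zero_of_not_isNonposInt hs (k + 1)
  simp only [Pi.div_apply]
  rw [div_mul_div_comm, div_mul_div_comm, div_div_div_eq,
    div_eq_div_iff (by simp [e1, hf, p1, p2]) (mul_ne_zero p1 p2)]
  linear_combination (-(poch (1 + A - D) (k + 1) * poch (1 + A - E) (k + 1) * poch (1 + A) (k + 1) *
    poch (1 + A - D - E) (k + 1) * k.factorial ^ 2)) * hpow

/-! ### Passage to the limit and the theorem -/

/-- The limit of the Saalschützian side. -/
lemma exists_limit_saalschutz (A B C D E G : ℂ) (hb : ∀ x ∈ [1 + A - B, 1 + A - C, G], ¬ IsNonposInt x)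
    (h : 0 < (1 + A - D - E).re ∨ ∃ x ∈ [A - B - C, D, E], IsNonposInt x) :
    ∃ S : ℂ, HasHypSum [A - B - C, D, E, G + 1] [1 + A - B, 1 + A - C, G] 1 S ∧
      Tendsto (fun n : ℕ => ∑ k ∈ Finset.range (n + 1), hypTerm [A - B - C, D, E, -(n : ℂ), G + 1]
        [1 + A - B, 1 + A - C, D + E + -(n : ℂ) - A, G] 1 k) atTop (𝓝 S) := by
  have e : ∀ n k : ℕ, hypTerm [A - B - C, D, E, -(n : ℂ), G + 1]
      [1 + A - B, 1 + A - C, D + E + -(n : ℂ) - A, G] 1 k =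
      hypTerm [A - B - C, D, E, G + 1] [1 + A - B, 1 + A - C, G] 1 k *
        saalschutzFactor (1 + A - D - E) n k := by
    intro n k
    rw [saalschutzFactor_eq,
      show D + E + -(n : ℂ) - A = 1 - (1 + A - D - E) - n by ring]
    simp only [hypTerm, List.map_cons, List.map_nil, List.prod_cons, List.prod_nil, mul_one,
      ← poch.eq_def, div_eq_mul_inv, mul_inv]
    ring
  simp_rw [e]
  rcases h with h | ⟨x, hx, m, rfl⟩
  · obtain ⟨K, hK, hc⟩ := exists_bound_hypTerm [A - B - C, D, E, G + 1] [1 + A - B, 1 + A - C, G] 1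
      (by simp) hb rfl
    -- The terms are `O((k+1)^(-Re s - 1))` with `s = 1 + A - D - E`; the minimum with `1/2` secures
    -- `σ < 1`.
    refine tendsto_sum_mul_saalschutzFactor (σ := min (1 + A - D - E).re (1 / 2)) (K := K)
      (lt_min h (by norm_num)) ((min_le_right _ _).trans_lt (by norm_num)) (min_le_left _ _) hK
      fun k => (hc k).trans ?_
    refine mul_le_mul_of_nonneg_left (Real.rpow_le_rpow_of_exponent_le (by simp) ?_) hK.le
    have h1 := min_le_left (1 + A - D - E).re (1 / 2)
    have h2 : ([A - B - C, D, E, G + 1].sum - [1 + A - B, 1 + A - C, G].sum).re =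
        -(1 + A - D - E).re := by
      rw [← Complex.neg_re]
      congr 1
      simp only [List.sum_cons, List.sum_nil]
      ring
    rw [h2]
    linarith
  · refine tendsto_sum_of_eventually_zero (K := m + 1) (fun k hk => hypTerm_eq_zero (m := m) ?_ hk)
      (tendsto_saalschutzFactor _)
    simp only [List.mem_cons, List.not_mem_nil, or_false] at hx ⊢
    tauto

/-- The limit of the well-poised side. -/
lemma exists_limit_wellPoised (A B C D E ω : ℂ)
    (hb : ∀ x ∈ [A / 2, 1 + A - B, 1 + A - C, 1 + A - D, 1 + A - E, A / 2 - ω, A / 2 + ω],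
      ¬ IsNonposInt x)
    (h : 0 < (3 * A + 2 - 2 * (B + C + D + E)).re ∨ ∃ x ∈ [B, C, D, E], IsNonposInt x) :
    ∃ T : ℂ, HasHypSum [A, 1 + A / 2, B, C, D, E, A / 2 - ω + 1, A / 2 + ω + 1]
        [A / 2, 1 + A - B, 1 + A - C, 1 + A - D, 1 + A - E, A / 2 - ω, A / 2 + ω] (-1) T ∧
      Tendsto (fun n : ℕ => ∑ k ∈ Finset.range (n + 1),
        hypTerm [A, 1 + A / 2, B, C, D, E, -(n : ℂ), A / 2 - ω + 1, A / 2 + ω + 1]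
          [A / 2, 1 + A - B, 1 + A - C, 1 + A - D, 1 + A - E, 1 + A - -(n : ℂ),
            A / 2 - ω, A / 2 + ω] 1 k) atTop (𝓝 T) := by
  have e1 : ∀ k : ℕ, hypTerm [A, 1 + A / 2, B, C, D, E, A / 2 - ω + 1, A / 2 + ω + 1]
        [A / 2, 1 + A - B, 1 + A - C, 1 + A - D, 1 + A - E, A / 2 - ω, A / 2 + ω] (-1) k =
      (-1) ^ k * hypTerm [A, 1 + A / 2, B, C, D, E, A / 2 - ω + 1, A / 2 + ω + 1]
        [A / 2, 1 + A - B, 1 + A - C, 1 + A - D, 1 + A - E, A / 2 - ω, A / 2 + ω] 1 k := by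
    intro k
    rw [hypTerm, hypTerm, one_pow]
    ring
  have e2 : ∀ n k : ℕ, hypTerm [A, 1 + A / 2, B, C, D, E, -(n : ℂ), A / 2 - ω + 1, A / 2 + ω + 1]
          [A / 2, 1 + A - B, 1 + A - C, 1 + A - D, 1 + A - E, 1 + A - -(n : ℂ),
            A / 2 - ω, A / 2 + ω] 1 k =
      (-1) ^ k * (hypTerm [A, 1 + A / 2, B, C, D, E, A / 2 - ω + 1, A / 2 + ω + 1]
        [A / 2, 1 + A - B, 1 + A - C, 1 + A - D, 1 + A - E, A / 2 - ω, A / 2 + ω] 1 k *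
        poisedFactor A n k) := by
    intro n k
    have h5 : ((-1 : ℂ)) ^ k * (-1) ^ k = 1 := by rw [← mul_pow]; simp
    have h6 : ∀ x y z : ℂ, (-1) ^ k * (x * ((-1) ^ k * y / z)) = x * (y / z) := fun x y z => by
      linear_combination (x * (y / z)) * h5
    rw [poisedFactor_eq, h6]
    simp only [hypTerm, List.map_cons, List.map_nil, List.prod_cons, List.prod_nil, mul_one,
      ← poch.eq_def, div_eq_mul_inv, mul_inv]
    ring
  simp_rw [HasHypSum, e1, e2]
  rcases h with h | ⟨x, hx, m, rfl⟩
  · obtain ⟨K, hK, hd⟩ := exists_bound_hypTerm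
      [A, 1 + A / 2, B, C, D, E, A / 2 - ω + 1, A / 2 + ω + 1]
      [A / 2, 1 + A - B, 1 + A - C, 1 + A - D, 1 + A - E, A / 2 - ω, A / 2 + ω] 1 (by simp) hb rfl
    obtain ⟨K', hK', hd'⟩ := exists_bound_hypTerm_sub
      [A, 1 + A / 2, B, C, D, E, A / 2 - ω + 1, A / 2 + ω + 1]
      [A / 2, 1 + A - B, 1 + A - C, 1 + A - D, 1 + A - E, A / 2 - ω, A / 2 + ω] hb rfl
    obtain ⟨L, hq, hq'⟩ := exists_bound_poisedFactor A
    refine tendsto_alternating_sum_mul (K := max K K') ?_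
      (fun k => (hd k).trans (mul_le_mul_of_nonneg_right (le_max_left _ _) (by positivity)))
      (fun k => (hd' k).trans (mul_le_mul_of_nonneg_right (le_max_right _ _) (by positivity)))
      (tendsto_poisedFactor A) (fun n k => poisedFactor_eq_zero A) hq hq'
    have h2 : ([A, 1 + A / 2, B, C, D, E, A / 2 - ω + 1, A / 2 + ω + 1].sum -
        [A / 2, 1 + A - B, 1 + A - C, 1 + A - D, 1 + A - E, A / 2 - ω, A / 2 + ω].sum).re - 1 =
        -(3 * A + 2 - 2 * (B + C + D + E)).re := by
      rw [← Complex.neg_re, ← Complex.one_re, ← Complex.sub_re]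
      congr 1
      simp only [List.sum_cons, List.sum_nil]
      ring
    rw [h2]
    linarith
  · simp_rw [← mul_assoc]
    refine tendsto_sum_of_eventually_zero (K := m + 1) (fun k hk => ?_) (tendsto_poisedFactor A)
    rw [hypTerm_eq_zero (m := m) _ hk, mul_zero]
    simp only [List.mem_cons, List.not_mem_nil, or_false] at hx ⊢
    tauto

lemma not_isNonposInt_of_lowerNonzero {b : List ℂ} (h : ∀ n, LowerNonzero b n) :
    ∀ x ∈ b, ¬ IsNonposInt x := by
  rintro x hx ⟨m, hm⟩
  exact h (m + 1) x hx m (Nat.lt_succ_self m) (by rw [hm]; ring)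

theorem mainTheorem8 (A B C D E G ω : ℂ) (hG : A - B - C - G ≠ 0)
    (hω : ω ^ 2 = G * B * C / (A - B - C - G) + A ^ 2 / 4) :
    -- the terminating transformation, `-F = n ∈ ℕ`
    (∀ (n : ℕ) (F : ℂ), F = -(n : ℂ) →
      LowerNonzero [1 + A - B, 1 + A - C, D + E + F - A, G] n →
      LowerNonzero [A / 2, 1 + A - B, 1 + A - C, 1 + A - D, 1 + A - E, 1 + A - F,
        A / 2 - ω, A / 2 + ω] n →
      ¬ IsNonposInt (A + 1) → ¬ IsNonposInt (1 + A - D - F) →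
      ¬ IsNonposInt (1 + A - E - F) → ¬ IsNonposInt (1 + A - D - E) →
      ∃ S T : ℂ,
        HasHypSum [A - B - C, D, E, F, G + 1] [1 + A - B, 1 + A - C, D + E + F - A, G] 1 S ∧
        HasHypSum [A, 1 + A / 2, B, C, D, E, F, A / 2 - ω + 1, A / 2 + ω + 1]
          [A / 2, 1 + A - B, 1 + A - C, 1 + A - D, 1 + A - E, 1 + A - F,
            A / 2 - ω, A / 2 + ω] 1 T ∧
        S = Complex.Gamma (A + 1) * Complex.Gamma (1 + A - D - F) *
              Complex.Gamma (1 + A - E - F) * Complex.Gamma (1 + A - D - E) /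
            (Complex.Gamma (1 + A - F) * Complex.Gamma (1 + A - D) *
              Complex.Gamma (1 + A - E) * Complex.Gamma (1 + A - D - E - F)) * T) ∧
    -- the non-terminating transformation, on the whole range where both series converge
    ((∀ n, LowerNonzero [1 + A - B, 1 + A - C, G] n) →
      (∀ n, LowerNonzero [A / 2, 1 + A - B, 1 + A - C, 1 + A - D, 1 + A - E,
        A / 2 - ω, A / 2 + ω] n) →
      ¬ IsNonposInt (A + 1) → ¬ IsNonposInt (1 + A - D - E) →
      (0 < (1 + A - D - E).re ∨ ∃ x ∈ [A - B - C, D, E], IsNonposInt x) →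
      (0 < (3 * A + 2 - 2 * (B + C + D + E)).re ∨ ∃ x ∈ [B, C, D, E], IsNonposInt x) →
      ∃ S T : ℂ,
        HasHypSum [A - B - C, D, E, G + 1] [1 + A - B, 1 + A - C, G] 1 S ∧
        HasHypSum [A, 1 + A / 2, B, C, D, E, A / 2 - ω + 1, A / 2 + ω + 1]
          [A / 2, 1 + A - B, 1 + A - C, 1 + A - D, 1 + A - E, A / 2 - ω, A / 2 + ω] (-1) T ∧
        S = Complex.Gamma (A + 1) * Complex.Gamma (1 + A - D - E) /
            (Complex.Gamma (1 + A - D) * Complex.Gamma (1 + A - E)) * T) := by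
  constructor
  · rintro n F rfl h1 h2 hA hDF hEF hs
    refine ⟨_, _, hasHypSum_of_mem (m := n) (by simp), hasHypSum_of_mem (m := n) (by simp), ?_⟩
    have hD : ¬ IsNonposInt (1 + A - D) := not_isNonposInt_of_add_nat (n := n)
      (fun k hk => h2 _ (by simp) k hk) (by simpa using hDF)
    have hE : ¬ IsNonposInt (1 + A - E) := not_isNonposInt_of_add_nat (n := n)
      (fun k hk => h2 _ (by simp) k hk) (by simpa using hEF)
    rw [gamma_quotient hA hs hD hE]
    exact terminating_transformation A B C D E G ω hG hω n h1 h2 hA hs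
  · intro h1 h2 hA hs hS hT
    have b1 := not_isNonposInt_of_lowerNonzero h1
    have b2 := not_isNonposInt_of_lowerNonzero h2
    obtain ⟨S, hS1, hS2⟩ := exists_limit_saalschutz A B C D E G b1 hS
    obtain ⟨T, hT1, hT2⟩ := exists_limit_wellPoised A B C D E ω b2 hT
    refine ⟨S, T, hS1, hT1, tendsto_nhds_unique hS2 ?_⟩
    have hpre := tendsto_gamma_quotient hA hs (b2 _ (by simp)) (b2 _ (by simp))
    refine (hpre.mul hT2).congr fun n =>
      (terminating_transformation A B C D E G ω hG hω n ?_ ?_ hA hs).symm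
    · have h1 := h1 n
      simp only [LowerNonzero, List.mem_cons, List.not_mem_nil, or_false, forall_eq_or_imp,
        forall_eq] at h1 ⊢
      -- A zero of `D + E - n - A + k` with `k < n` would make `1 + A - D - E` equal to `-(n-k-1)`.
      refine ⟨h1.1, h1.2.1, fun k hk h => hs ⟨n - (k + 1), ?_⟩, h1.2.2⟩
      rw [Nat.cast_sub hk]
      push_cast
      linear_combination -h
    · have h2 := h2 n
      simp only [LowerNonzero, List.mem_cons, List.not_mem_nil, or_false, forall_eq_or_imp,
        forall_eq] at h2 ⊢
      obtain ⟨c1, c2, c3, c4, c5, c6, c7⟩ := h2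
      refine ⟨c1, c2, c3, c4, c5, fun k _ h => hA ⟨n + k, ?_⟩, c6, c7⟩
      push_cast
      linear_combination h
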